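/- Let $p>q$ be primes and let $0<a<1<b$ satisfy $(q-1)a+b=q$. For $n\ge 2$, the $n$-adic intervals are $Q=\left[\frac{k-1}{n^m},\frac{k}{n^m}\right)$, $m,k\in\mathbb Z$; the children of $Q$ are its $n$ successive $n$-adic subintervals $Q_1,\dots,Q_n$ of length $|Q|/n$; $\Upsilon(Q)$ denotes the right endpoint of $Q_1$ and $Z(Q)$ the left endpoint of $Q_n$. Let $\{I_\ell\}_{\ell}$ be a sequence of $q$-adic intervals, with integers $\alpha_\ell\ge 1$, and let $J^\ell$ be the smallest $p$-adic interval containing $I_\ell$, such that: the $J^\ell$ are pairwise disjoint and contained in $[0,1)$; for every $\alpha$ only finitely many $\ell$ have $\alpha_\ell=\alpha$; and $0<\Upsilon(J^\ell)-Z(I_\ell)\le q^{-100\alpha_\ell}|I_\ell|$ for every $\ell$. The weight $w_\mu$ on $\mathbb R$ (the density of the measure $\mu$) equals $1$ outside $\bigcup_\ell I_\ell$, and on $I=I_\ell$, $\alpha=\alpha_\ell$, it is the density obtained from Lebesgue measure by the following $2\alpha$ steps. Put $H^{(1)}=I_{q-1}$, $G^{(1)}=I_q$ (children of $I$), and $H^{(k+1)}=H^{(k)}_q$,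 $G^{(k+1)}=G^{(k)}_1$ for $k\ge1$. Step $1$: multiply the density by $b$ on $I_q$ and by $a$ on the other children of $I$. Step $k$, $2\le k\le\alpha$: on each of $K=H^{(k-1)}$ and $K=G^{(k-1)}$, multiply the density by $b$ on the first child $K_1$ and by $a$ on the other children of $K$. Step $k$, $\alpha+1\le k\le 2\alpha$: on each of $K=H^{(k-1)}$ and $K=G^{(k-1)}$, multiply the density by $b$ on the last child $K_q$ and by $a$ on the other children of $K$. For $r>1$, a weight (nonnegative locally integrable function) $w$ on $\mathbb R$ belongs to the $p$-adic reverse Hölder class $RH_r^p$ if there is a constant $C$ with $$\left(\frac1{|Q|}\int_Q w^r\right)^{1/r}\le \frac{C}{|Q|}\int_Q w<\infty\qquad\text{for all $p$-adic intervals } Q,$$ and the measure $w\,dx$ is $p$-adic doubling, i.e. the ratios of the masses of any two children of a $p$-adic interval lie in $[1/C',C']$ for some constant $C'$. Put $RH_1^p=\bigcup_{r>1}RH_r^p$. **Proposition.** For every $r$ with $1<r<\frac{\ln q}{\ln b}$ one has $w_\mu\in RH_r^p$. In particular, $w_\mu\in RH_1^p$. -/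

import Mathlib

open MeasureTheory Set
open scoped ENNReal NNReal

noncomputable section

/-- The `n`-adic interval `[(k - 1) / n ^ m, k / n ^ m)`, with `m = gen` and `k = idx`
arbitrary integers. -/
structure NAdic (n : ℕ) where
  gen : ℤ
  idx : ℤ

namespace NAdic

variable {n : ℕ}

/-- left endpoint -/
def left (I : NAdic n) : ℝ := ((I.idx : ℝ) - 1) / (n : ℝ) ^ I.gen

/-- right endpoint -/
def right (I : NAdic n) : ℝ := (I.idx : ℝ) / (n : ℝ) ^ I.gen

/-- The interval as a (half-open) set of real numbers. -/
def toSet (I : NAdic n) : Set ℝ := Ico I.left I.right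

/-- length -/
def length (I : NAdic n) : ℝ := I.right - I.left

/-- The `j`-th `n`-adic child, `1 ≤ j ≤ n`, counted from the left; see `child_left` and
`child_right` for its endpoints. -/
def child (I : NAdic n) (j : ℕ) : NAdic n := ⟨I.gen + 1, n * (I.idx - 1) + j⟩

theorem child_left (hn : n ≠ 0) (I : NAdic n) (j : ℕ) :
    (I.child j).left = I.left + ((j : ℝ) - 1) / (n : ℝ) ^ (I.gen + 1) := by
  have h : (n : ℝ) ≠ 0 := by exact_mod_cast hn
  have h2 : (n : ℝ) ^ I.gen ≠ 0 := zpow_ne_zero _ h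
  simp only [left, child, zpow_add_one₀ h]
  push_cast
  field_simp
  ring

theorem child_right (hn : n ≠ 0) (I : NAdic n) (j : ℕ) :
    (I.child j).right = I.left + (j : ℝ) / (n : ℝ) ^ (I.gen + 1) := by
  have h : (n : ℝ) ≠ 0 := by exact_mod_cast hn
  have h2 : (n : ℝ) ^ I.gen ≠ 0 := zpow_ne_zero _ h
  simp only [left, right, child, zpow_add_one₀ h]
  push_cast
  field_simp

/-- The distinguished point `Υ`: the right endpoint of the leftmost child. -/
def upsilon (I : NAdic n) : ℝ := (I.child 1).right

/-- The distinguished point `Z`: the left endpoint of the rightmost child. -/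
def zeta (I : NAdic n) : ℝ := (I.child n).left

/-- The intervals `H^(k)`, `k ≥ 1`: `H^(1)` is the child number `n - 1` of `I`, and `H^(k+1)` is
the rightmost child of `H^(k)`. (The value at `k = 0` is never used.) -/
def hInt (I : NAdic n) : ℕ → NAdic n
  | 0 => I
  | 1 => I.child (n - 1)
  | k + 2 => (hInt I (k + 1)).child n

/-- The intervals `G^(k)`, `k ≥ 1`: `G^(1)` is the rightmost child of `I`, and `G^(k+1)` is
the leftmost child of `G^(k)`. (The value at `k = 0` is never used.) -/
def gInt (I : NAdic n) : ℕ → NAdic n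
  | 0 => I
  | 1 => I.child n
  | k + 2 => (gInt I (k + 1)).child 1

open Classical in
/-- The factor by which the density at `x` changes when the mass of `K` is redistributed among its
`n` children with relative density `b` on the child number `j` and `a` on all the others. -/
def redistribute (a b : ℝ) (K : NAdic n) (j : ℕ) (x : ℝ) : ℝ :=
  if x ∈ (K.child j).toSet then b else if x ∈ K.toSet then a else 1

/-- The factor by which the step number `k` of the construction on `I` changes the density:
* step `1` redistributes the mass of `I`, with `b` on the rightmost child;
* step `k` with `2 ≤ k ≤ α` redistributes the masses of `H^(k-1)` and of `G^(k-1)`, with `b` on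
  their leftmost children;
* step `k` with `k ≥ 2`, `k > α` redistributes the masses of `H^(k-1)` and of `G^(k-1)`, with `b`
  on their rightmost children. -/
def stepFactor (a b : ℝ) (α : ℕ) (I : NAdic n) : ℕ → ℝ → ℝ
  | 0, _ => 1
  | 1, x => redistribute a b I n x
  | k + 2, x =>
      if k + 2 ≤ α then
        redistribute a b (I.hInt (k + 1)) 1 x * redistribute a b (I.gInt (k + 1)) 1 x
      else
        redistribute a b (I.hInt (k + 1)) n x * redistribute a b (I.gInt (k + 1)) n x

/-- The density on `I` after all the steps `1, …, 2α`, starting from Lebesgue measure. -/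
def localWeight (a b : ℝ) (α : ℕ) (I : NAdic n) (x : ℝ) : ℝ :=
  ∏ k ∈ Finset.Icc 1 (2 * α), stepFactor a b α I k x

end NAdic

/-- A collection of `q`-adic intervals `I ℓ` in `[0, 1)` with positive integers `α ℓ`, as it is
selected for the construction of the measure; `J ℓ` is the smallest `p`-adic interval that
contains `I ℓ`. -/
structure IsSelection (p q : ℕ) (I : ℕ → NAdic q) (J : ℕ → NAdic p) (α : ℕ → ℕ) : Prop where
  one_le_alpha : ∀ ℓ, 1 ≤ α ℓ
  subset : ∀ ℓ, (I ℓ).toSet ⊆ (J ℓ).toSet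
  smallest : ∀ ℓ, ∀ K : NAdic p, (I ℓ).toSet ⊆ K.toSet → (J ℓ).toSet ⊆ K.toSet
  subset_unit : ∀ ℓ, (J ℓ).toSet ⊆ Ico 0 1
  disjoint : ∀ ℓ ℓ', ℓ ≠ ℓ' → Disjoint (J ℓ).toSet (J ℓ').toSet
  finite_alpha : ∀ m : ℕ, {ℓ | α ℓ = m}.Finite
  zeta_lt : ∀ ℓ, 0 < (J ℓ).upsilon - (I ℓ).zeta
  close : ∀ ℓ, (J ℓ).upsilon - (I ℓ).zeta ≤ ((q : ℝ) ^ (100 * α ℓ))⁻¹ * (I ℓ).length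

open Classical in
/-- The weight `w_μ`: the density of the measure `μ` which is given by the construction on every
`I ℓ` (they are pairwise disjoint) and is Lebesgue measure elsewhere. -/
def constructedWeight {q : ℕ} (a b : ℝ) (I : ℕ → NAdic q) (α : ℕ → ℕ) (x : ℝ) : ℝ :=
  if h : ∃ ℓ, x ∈ (I ℓ).toSet then
    NAdic.localWeight a b (α h.choose) (I h.choose) x
  else 1

/-- A weight: a nonnegative locally integrable function on the line. -/
def IsWeight (w : ℝ → ℝ) : Prop := (∀ x, 0 ≤ w x) ∧ LocallyIntegrable w volume

/-- `μ` is `n`-adic doubling: the ratios of the masses of any two `n`-adic children of an `n`-adic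
interval lie between `1 / C` and `C`. (The quotients are taken in `[0, ∞]`, where `0 / 0 = 0`, so
that the children have positive mass.) -/
def IsNAdicDoubling (n : ℕ) (μ : Measure ℝ) : Prop :=
  ∃ C : ℝ≥0, 0 < C ∧ ∀ I : NAdic n, ∀ i ∈ Finset.Icc 1 n, ∀ j ∈ Finset.Icc 1 n,
    (C : ℝ≥0∞)⁻¹ ≤ μ (I.child i).toSet / μ (I.child j).toSet ∧
      μ (I.child i).toSet / μ (I.child j).toSet ≤ C

/-- The measure `w dx`. -/
def weightMeasure (w : ℝ → ℝ) : Measure ℝ :=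
  volume.withDensity fun x => ENNReal.ofReal (w x)

/-- The `n`-adic reverse Hölder class `RH_r^n` (for `r > 1`). -/
def RHAdic (n : ℕ) (r : ℝ) : Set (ℝ → ℝ) :=
  {w | IsWeight w ∧
    (∀ Q : NAdic n, IntegrableOn (fun x => w x ^ r) Q.toSet volume) ∧
    (∃ C : ℝ, ∀ Q : NAdic n,
      (⨍ x in Q.toSet, w x ^ r) ^ (1 / r) ≤ C * ⨍ x in Q.toSet, w x) ∧
    IsNAdicDoubling n (weightMeasure w)}

/-- The class `RH_1^n`, the union of the classes `RH_r^n` over `r > 1`. -/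
def RHAdicOne (n : ℕ) : Set (ℝ → ℝ) := ⋃ (r : ℝ) (_ : 1 < r), RHAdic n r

end

/-! On one `I = I_ℓ` the weight has, up to constant factors, an explicit profile around `Z(I)`. At
distance about `q^(-k)|I|` to the right of `Z(I)` it is `b^k` for `k ≤ α` and `b^α a^(k-α)` for `α ≤
k ≤ 2α`. To the left it is `a^k`, then `a^α b^(k-α)`. Closer still, both sides are the constant
`(ab)^α`. The two sides may differ greatly at intermediate scales, but each side varies slowly:
moving from distance `u` to `v ≥ u` changes the weight at most by powers of `v / u`
(`localWeight_slow_variation`). The exponent that governs the size near the center is `s = log_q b`,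
and `r < ln q / ln b` says exactly that `s r < 1`, so that the `r`-th power of the singularity is
integrable.

The center may be moved from `Z(I)` to `c = Υ(J)`, because their distance is far below the scale
`q^(-2α)|I|` at which the profile flattens. Now `c` is an endpoint of a child of `J`, so every
`p`-adic interval strictly shorter than `J` lies on one side of `c`. On such an interval the weight
is comparable with its value `F` at the endpoint farther from `c`, with losses that are only powers
of the distance to the boundary (`isTameOn_localWeight`). This bounds the means of `w` and `w^r` by
multiples of `F` and `F^r`, and the mass of every child from below by a multiple of `F|Q|`.

Any other `p`-adic interval `Q` contains or misses each `J_ℓ`. The two intervals of length `|J|`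
flanking `c` have their far endpoints outside `I`, where the weight is `1`. Hence on `J` the same
estimates hold with `F = 1`, and summation over `ℓ` gives them on `Q`. The bounds of `exists_bounds`
imply both the reverse Hölder inequality and doubling. -/

namespace NAdic

variable {n : ℕ}

/-! ### Geometry of `n`-adic intervals. -/

theorem length_eq (I : NAdic n) : I.length = ((n : ℝ) ^ I.gen)⁻¹ := by
  simp only [length, left, right]
  rw [div_sub_div_same, inv_eq_one_div]
  ring_nf

theorem length_pos (hn : n ≠ 0) (I : NAdic n) : 0 < I.length := by
  rw [length_eq]
  have : (0 : ℝ) < n := by positivity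
  positivity

theorem right_eq (I : NAdic n) : I.right = I.left + I.length := by
  simp [length]

theorem toSet_eq (I : NAdic n) : I.toSet = Ico I.left (I.left + I.length) := by
  rw [toSet, right_eq]

theorem left_eq (I : NAdic n) : I.left = ((I.idx : ℝ) - 1) * I.length := by
  rw [length_eq, left, div_eq_mul_inv]

theorem child_length (hn : n ≠ 0) (I : NAdic n) (j : ℕ) :
    (I.child j).length = I.length / n := by
  have h : (n : ℝ) ≠ 0 := by exact_mod_cast hn
  simp only [length_eq, child, zpow_add_one₀ h]
  rw [mul_inv, div_eq_mul_inv]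

theorem child_left' (hn : n ≠ 0) (I : NAdic n) (j : ℕ) :
    (I.child j).left = I.left + ((j : ℝ) - 1) * (I.length / n) := by
  rw [child_left hn, ← child_length hn I 0, length_eq, div_eq_mul_inv]
  rfl

theorem child_toSet (hn : n ≠ 0) (I : NAdic n) (j : ℕ) :
    (I.child j).toSet = Ico (I.left + ((j : ℝ) - 1) * (I.length / n))
      (I.left + (j : ℝ) * (I.length / n)) := by
  rw [toSet_eq, child_length hn, child_left' hn]
  congr 1
  ring

theorem upsilon_eq (hn : n ≠ 0) (I : NAdic n) : I.upsilon = I.left + I.length / n := by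
  rw [upsilon, right_eq, child_left' hn, child_length hn]
  simp

theorem zeta_eq (hn : n ≠ 0) (I : NAdic n) :
    I.zeta = I.left + I.length - I.length / n := by
  have h : (n : ℝ) ≠ 0 := by exact_mod_cast hn
  rw [zeta, child_left' hn]
  field_simp
  ring

theorem child_subset (hn : n ≠ 0) (I : NAdic n) {j : ℕ} (hj : 1 ≤ j) (hjn : j ≤ n) :
    (I.child j).toSet ⊆ I.toSet := by
  have hL := I.length_pos hn
  have h : (0 : ℝ) < n := by positivity
  have h1 : (1 : ℝ) ≤ j := by exact_mod_cast hj
  have h2 : (j : ℝ) ≤ n := by exact_mod_cast hjn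
  have h3 : (n : ℝ) * (I.length / n) = I.length := by field_simp
  have h4 : 0 < I.length / n := by positivity
  rw [child_toSet hn, toSet_eq]
  apply Ico_subset_Ico <;> nlinarith

theorem exists_length_eq_mul (hn : n ≠ 0) {Q K : NAdic n} (h : K.gen ≤ Q.gen) :
    ∃ d : ℕ, K.length = d * Q.length := by
  have hn' : (n : ℝ) ≠ 0 := by exact_mod_cast hn
  obtain ⟨d, hd⟩ := Int.eq_ofNat_of_zero_le (sub_nonneg.2 h)
  refine ⟨n ^ d, ?_⟩
  have : Q.gen = K.gen + d := by omega
  rw [length_eq, length_eq, this, zpow_add₀ hn']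
  push_cast
  rw [zpow_natCast]
  field_simp

/-- An `n`-adic interval is contained in or disjoint from every `n`-adic interval which is at
least as long. -/
theorem subset_or_disjoint (hn : n ≠ 0) {Q K : NAdic n} (h : K.gen ≤ Q.gen) :
    Q.toSet ⊆ K.toSet ∨ Disjoint Q.toSet K.toSet := by
  obtain ⟨d, hd⟩ := exists_length_eq_mul hn h
  have hQ := Q.length_pos hn
  rw [toSet_eq, toSet_eq, left_eq Q, left_eq K, hd]
  set t := Q.length
  by_cases h1 : (K.idx - 1) * d ≤ Q.idx - 1 ∧ Q.idx ≤ (K.idx - 1) * d + d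
  · left
    have h2 : ((K.idx : ℝ) - 1) * d ≤ Q.idx - 1 := by exact_mod_cast h1.1
    have h3 : (Q.idx : ℝ) ≤ (K.idx - 1) * d + d := by exact_mod_cast h1.2
    apply Ico_subset_Ico <;> nlinarith
  · right
    rw [not_and_or, not_le, not_le] at h1
    rw [Set.disjoint_left]
    rintro x ⟨hx1, hx2⟩ ⟨hx3, hx4⟩
    rcases h1 with h1 | h1
    · have h2 : (Q.idx : ℝ) ≤ ((K.idx : ℝ) - 1) * d := by
        have : Q.idx ≤ (K.idx - 1) * d := by omega
        exact_mod_cast this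
      nlinarith
    · have h2 : (K.idx - 1) * d + d ≤ (Q.idx : ℝ) - 1 := by
        have : (K.idx - 1) * d + d ≤ Q.idx - 1 := by omega
        exact_mod_cast this
      nlinarith

/-- `Υ(J)` is an endpoint of a child of `J`, hence a point of the grid of every finer generation.
Thus `Υ(J)` is never interior to `Q`. -/
theorem exists_left_eq_upsilon_add (hn : n ≠ 0) {Q J : NAdic n} (h : J.gen < Q.gen) :
    ∃ m : ℤ, Q.left = J.upsilon + m * Q.length := by
  obtain ⟨d, hd⟩ := exists_length_eq_mul (K := J.child 1) (Q := Q) hn (by simpa [child] using h)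
  refine ⟨Q.idx - 1 - (J.child 1).idx * d, ?_⟩
  rw [upsilon, right_eq, left_eq Q, left_eq (J.child 1), hd]
  push_cast
  ring

theorem gInt_endpoints (hn : n ≠ 0) (I : NAdic n) (k : ℕ) :
    (I.gInt (k + 1)).left = I.zeta ∧ (I.gInt (k + 1)).length = I.length / n ^ (k + 1) := by
  induction k with
  | zero => exact ⟨rfl, by simp [gInt, child_length hn]⟩
  | succ k ih =>
    rw [gInt, child_left' hn, child_length hn, ih.1, ih.2]
    constructor
    · simp
    · rw [div_div, pow_succ _ (k + 1)]

theorem hInt_endpoints (hn : 2 ≤ n) (I : NAdic n) (k : ℕ) :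
    (I.hInt (k + 1)).left = I.zeta - I.length / n ^ (k + 1) ∧
      (I.hInt (k + 1)).length = I.length / n ^ (k + 1) := by
  have hn0 : n ≠ 0 := by omega
  have h : (n : ℝ) ≠ 0 := by exact_mod_cast hn0
  induction k with
  | zero =>
    refine ⟨?_, by simp [hInt, child_length hn0]⟩
    rw [hInt, child_left' hn0, zeta_eq hn0]
    push_cast [show 1 ≤ n by omega]
    field_simp
    ring
  | succ k ih =>
    rw [hInt, child_left' hn0, child_length hn0, ih.1, ih.2]
    constructor
    · field_simp
      ring
    · rw [div_div, pow_succ _ (k + 1)]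

theorem gInt_toSet (hn : n ≠ 0) (I : NAdic n) (k : ℕ) :
    (I.gInt (k + 1)).toSet = Ico I.zeta (I.zeta + I.length / n ^ (k + 1)) := by
  rw [toSet_eq, (gInt_endpoints hn I k).1, (gInt_endpoints hn I k).2]

theorem hInt_toSet (hn : 2 ≤ n) (I : NAdic n) (k : ℕ) :
    (I.hInt (k + 1)).toSet = Ico (I.zeta - I.length / n ^ (k + 1)) I.zeta := by
  rw [toSet_eq, (hInt_endpoints hn I k).1, (hInt_endpoints hn I k).2, sub_add_cancel]

theorem gInt_subset (hn : n ≠ 0) (I : NAdic n) (k : ℕ) : (I.gInt (k + 1)).toSet ⊆ I.toSet := by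
  induction k with
  | zero => exact child_subset hn I (by omega) le_rfl
  | succ k ih => exact (child_subset hn _ le_rfl (by omega)).trans ih

theorem hInt_subset (hn : 2 ≤ n) (I : NAdic n) (k : ℕ) : (I.hInt (k + 1)).toSet ⊆ I.toSet := by
  induction k with
  | zero => exact child_subset (by omega) I (by omega) (by omega)
  | succ k ih => exact (child_subset (by omega) _ (by omega) le_rfl).trans ih

theorem measurableSet_toSet (I : NAdic n) : MeasurableSet I.toSet := measurableSet_Ico

end NAdic

/-! ### Size and measurability of the local weight. -/

namespace NAdic

variable {n : ℕ}

theorem redistribute_of_notMem (hn : n ≠ 0) {a b : ℝ} {K : NAdic n} {j : ℕ} (hj : 1 ≤ j)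
    (hjn : j ≤ n) {x : ℝ} (hx : x ∉ K.toSet) : redistribute a b K j x = 1 := by
  have : x ∉ (K.child j).toSet := fun h => hx (child_subset hn K hj hjn h)
  simp [redistribute, hx, this]

theorem redistribute_mem_Icc {a b : ℝ} (ha1 : a ≤ 1) (hb : 1 ≤ b) (K : NAdic n) (j : ℕ) (x : ℝ) :
    redistribute a b K j x ∈ Icc a b := by
  unfold redistribute
  split_ifs
  exacts [⟨ha1.trans hb, le_rfl⟩, ⟨le_rfl, ha1.trans hb⟩, ⟨ha1, hb⟩]

theorem measurable_redistribute (a b : ℝ) (K : NAdic n) (j : ℕ) :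
    Measurable (redistribute a b K j) := by
  unfold redistribute
  exact Measurable.ite (measurableSet_toSet _) measurable_const
    (Measurable.ite (measurableSet_toSet _) measurable_const measurable_const)

theorem measurable_stepFactor (a b : ℝ) (α : ℕ) (I : NAdic n) (k : ℕ) :
    Measurable (stepFactor a b α I k) := by
  match k with
  | 0 => exact measurable_const
  | 1 => exact measurable_redistribute _ _ _ _
  | k + 2 =>
    by_cases h : k + 2 ≤ α
    all_goals
      simp only [funext_iff.2 fun x => stepFactor.eq_3 a b α I x k, h, if_true, if_false]
      exact (measurable_redistribute _ _ _ _).mul (measurable_redistribute _ _ _ _)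

theorem measurable_localWeight (a b : ℝ) (α : ℕ) (I : NAdic n) :
    Measurable (localWeight a b α I) := by
  unfold localWeight
  exact Finset.measurable_fun_prod _ fun k _ => measurable_stepFactor a b α I k

theorem localWeight_of_notMem (hn : 2 ≤ n) (a b : ℝ) (α : ℕ) (I : NAdic n) {x : ℝ}
    (hx : x ∉ I.toSet) : localWeight a b α I x = 1 := by
  have hn0 : n ≠ 0 := by omega
  refine Finset.prod_eq_one fun k _ => ?_
  match k with
  | 0 => rfl
  | 1 => exact redistribute_of_notMem hn0 (by omega) le_rfl hx
  | k + 2 =>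
    have h1 : x ∉ (I.hInt (k + 1)).toSet := fun h => hx (hInt_subset hn I k h)
    have h2 : x ∉ (I.gInt (k + 1)).toSet := fun h => hx (gInt_subset hn0 I k h)
    simp only [stepFactor]
    split_ifs
    all_goals
      rw [redistribute_of_notMem hn0 (by omega) (by omega) h1,
        redistribute_of_notMem hn0 (by omega) (by omega) h2, one_mul]

end NAdic

/-! ### The profile of the local weight around `zeta`. -/

/-- If the factors `f k` agree with `e k` as long as the decreasing condition `P k` holds, and
are trivial from the second failure of the condition on, then the product of the `f k` is
comparable with the product of the `e k` up to the last index for which the condition holds. -/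
theorem exists_level_prod {a b : ℝ} (ha1 : a ≤ 1) (hb : 1 ≤ b) {f e : ℕ → ℝ}
    {P : ℕ → Prop} (he : ∀ k, 0 < e k) (hP : ∀ k, P (k + 2) → P (k + 1))
    (hf : ∀ k, P (k + 1) → f (k + 1) = e (k + 1)) (hf' : ∀ k, f (k + 1) ∈ Icc a b)
    (hf1 : ∀ k, ¬ P (k + 1) → f (k + 2) = 1) (m : ℕ) :
    ∃ K ≤ m, (K = m ∨ ¬ P (K + 1)) ∧ (K = 0 ∨ P K) ∧
      a * ∏ k ∈ Finset.Icc 1 K, e k ≤ ∏ k ∈ Finset.Icc 1 m, f k ∧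
      ∏ k ∈ Finset.Icc 1 m, f k ≤ b * ∏ k ∈ Finset.Icc 1 K, e k := by
  have hE : ∀ K, 0 < ∏ k ∈ Finset.Icc 1 K, e k := fun K => Finset.prod_pos fun k _ => he k
  -- The induction must remember `¬ P m` after the first failure: it makes all later factors
  -- trivial, so only one factor in `[a, b]` is ever uncontrolled.
  have key : ((m = 0 ∨ P m) ∧ ∏ k ∈ Finset.Icc 1 m, f k = ∏ k ∈ Finset.Icc 1 m, e k) ∨
      ((¬ P m ∧ m ≠ 0) ∧ ∃ K < m, ¬ P (K + 1) ∧ (K = 0 ∨ P K) ∧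
      a * ∏ k ∈ Finset.Icc 1 K, e k ≤ ∏ k ∈ Finset.Icc 1 m, f k ∧
      ∏ k ∈ Finset.Icc 1 m, f k ≤ b * ∏ k ∈ Finset.Icc 1 K, e k) := by
    induction m with
    | zero => simp
    | succ m ih =>
      simp only [Finset.prod_Icc_succ_top (Nat.le_add_left 1 m)]
      rcases ih with ⟨h1, h2⟩ | ⟨⟨h0, h0'⟩, K, hK, h1, h2, h3, h4⟩
      · by_cases hPm : P (m + 1)
        · left
          exact ⟨Or.inr hPm, by rw [h2, hf m hPm]⟩
        · right
          refine ⟨⟨hPm, by omega⟩, m, by omega, hPm, h1, ?_, ?_⟩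
          · rw [h2, mul_comm]
            exact mul_le_mul_of_nonneg_left (hf' m).1 (hE m).le
          · rw [h2, mul_comm]
            exact mul_le_mul_of_nonneg_right (hf' m).2 (hE m).le
      · right
        obtain ⟨m, rfl⟩ := Nat.exists_eq_succ_of_ne_zero h0'
        refine ⟨⟨fun h => h0 (hP m h), by omega⟩, K, by omega, h1, h2, ?_⟩
        rw [hf1 m h0, mul_one]
        exact ⟨h3, h4⟩
  rcases key with ⟨h1, h2⟩ | ⟨-, K, hK, h1, h2, h3⟩
  · refine ⟨m, le_rfl, Or.inl rfl, h1, ?_, ?_⟩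
    · rw [h2]; nlinarith [hE m]
    · rw [h2]; nlinarith [hE m]
  · exact ⟨K, hK.le, Or.inr h1, h2, h3⟩

/-- The sequence of factors `u, …, u, v, v, …` with `v` from the index `α + 1` on. -/
def switchFactor (u v : ℝ) (α k : ℕ) : ℝ := if k ≤ α then u else v

/-- The result is symmetric in `u` and `v`: after all the steps the densities on the two sides of
`zeta` agree. -/
theorem prod_switchFactor (u v : ℝ) (α : ℕ) :
    ∏ k ∈ Finset.Icc 1 (2 * α), switchFactor u v α k = u ^ α * v ^ α := by
  have h : ∀ j, ∏ k ∈ Finset.Icc 1 (α + j), switchFactor u v α k = u ^ α * v ^ j := by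
    intro j
    induction j with
    | zero =>
      have : ∀ k ∈ Finset.Icc 1 α, switchFactor u v α k = u := fun k hk => by
        simp [switchFactor, (Finset.mem_Icc.1 hk).2]
      simp [Finset.prod_congr rfl this]
    | succ j ih =>
      rw [← add_assoc, Finset.prod_Icc_succ_top (by omega), ih, switchFactor, if_neg (by omega)]
      ring
  rw [two_mul, h]

namespace NAdic

variable {n : ℕ}

/-- The level `K` is the number of the nested intervals `G^(1), …, G^(2α)` that contain `x`, so it
measures the distance to `zeta` on a logarithmic scale. `G^(k)` is the first child of its parent for
`k ≥ 2`, so it receives `b` while the first children are favored and `a` afterwards. -/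
theorem exists_level_right (hn : 2 ≤ n) {a b : ℝ} (ha : 0 < a) (ha1 : a ≤ 1) (hb : 1 ≤ b) {α : ℕ}
    (hα : 1 ≤ α) (I : NAdic n) {x : ℝ} (hx : I.zeta ≤ x) :
    ∃ K ≤ 2 * α, (K = 2 * α ∨ I.length ≤ n ^ (K + 1) * (x - I.zeta)) ∧
      (K = 0 ∨ n ^ K * (x - I.zeta) ≤ I.length) ∧
      a * ∏ k ∈ Finset.Icc 1 K, switchFactor b a α k ≤ localWeight a b α I x ∧
      localWeight a b α I x ≤ b * ∏ k ∈ Finset.Icc 1 K, switchFactor b a α k := by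
  have hn0 : n ≠ 0 := by omega
  have hnp : (0 : ℝ) < n := by positivity
  have hH : ∀ k, x ∉ (I.hInt (k + 1)).toSet := fun k h => by
    rw [hInt_toSet hn] at h
    exact absurd h.2 hx.not_gt
  have hL := I.length_pos hn0
  have hnot : ∀ k, x ∉ (I.gInt (k + 1)).toSet → I.length ≤ n ^ (k + 1) * (x - I.zeta) := by
    intro k hk
    rw [gInt_toSet hn0, mem_Ico, not_and, not_lt] at hk
    have := hk hx
    rw [← le_sub_iff_add_le', div_le_iff₀' (by positivity)] at this
    exact this
  obtain ⟨K, hK, h1, h2, h3⟩ := exists_level_prod (f := fun k => stepFactor a b α I k x)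
    (e := switchFactor b a α) (P := fun k => x ∈ (I.gInt k).toSet) ha1 hb
    (fun k => by unfold switchFactor; split_ifs <;> linarith)
    (fun k => fun h => child_subset hn0 _ le_rfl (by omega) h)
    (by
      intro k hk
      match k with
      | 0 =>
        simp only [gInt] at hk
        simp [stepFactor, redistribute, switchFactor, hα, hk]
      | k + 1 =>
        have hG := child_subset hn0 _ le_rfl (by omega) hk
        have hn' : x ∉ ((I.gInt (k + 1)).child n).toSet := by
          simp only [gInt] at hk
          rw [child_toSet hn0] at hk ⊢
          intro h
          have h1 := hk.2
          have h2 := h.1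
          have h3 : (2 : ℝ) ≤ n := by exact_mod_cast hn
          have h4 : 0 < (I.gInt (k + 1)).length / n := div_pos (length_pos hn0 _) hnp
          push_cast at h1
          nlinarith
        simp only [gInt] at hk
        simp only [stepFactor, switchFactor]
        split_ifs
        · rw [redistribute_of_notMem hn0 (by omega) (by omega) (hH k)]
          simp [redistribute, hk]
        · rw [redistribute_of_notMem hn0 (by omega) (by omega) (hH k)]
          simp [redistribute, hG, hn'])
    (by
      intro k
      match k with
      | 0 => exact redistribute_mem_Icc ha1 hb _ _ _
      | k + 1 =>
        simp only [stepFactor]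
        split_ifs
        all_goals
          rw [redistribute_of_notMem hn0 (by omega) (by omega) (hH k), one_mul]
          exact redistribute_mem_Icc ha1 hb _ _ _)
    (by
      intro k hk
      simp only [stepFactor]
      split_ifs
      all_goals
        rw [redistribute_of_notMem hn0 (by omega) (by omega) (hH k),
          redistribute_of_notMem hn0 (by omega) (by omega) hk, one_mul]) (2 * α)
  refine ⟨K, hK, h1.imp_right (hnot K), ?_, h3⟩
  match K with
  | 0 => exact Or.inl rfl
  | K + 1 =>
    right
    have := h2.resolve_left (by omega)
    rw [gInt_toSet hn0] at this
    have := this.2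
    rw [← sub_lt_iff_lt_add', lt_div_iff₀' (by positivity)] at this
    exact this.le

/-- Mirror image with `H^(k)`, a last child for `k ≥ 2`: it receives `a` up to step `α` and `b`
afterwards. -/
theorem exists_level_left (hn : 2 ≤ n) {a b : ℝ} (ha : 0 < a) (ha1 : a ≤ 1) (hb : 1 ≤ b) {α : ℕ}
    (hα : 1 ≤ α) (I : NAdic n) {x : ℝ} (hx : x < I.zeta) :
    ∃ K ≤ 2 * α, (K = 2 * α ∨ I.length ≤ n ^ (K + 1) * (I.zeta - x)) ∧
      (K = 0 ∨ n ^ K * (I.zeta - x) ≤ I.length) ∧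
      a * ∏ k ∈ Finset.Icc 1 K, switchFactor a b α k ≤ localWeight a b α I x ∧
      localWeight a b α I x ≤ b * ∏ k ∈ Finset.Icc 1 K, switchFactor a b α k := by
  have hn0 : n ≠ 0 := by omega
  have hnp : (0 : ℝ) < n := by positivity
  have hG : ∀ k, x ∉ (I.gInt (k + 1)).toSet := fun k h => by
    rw [gInt_toSet hn0] at h
    exact absurd h.1 hx.not_ge
  have hL := I.length_pos hn0
  have hnot : ∀ k, x ∉ (I.hInt (k + 1)).toSet → I.length ≤ n ^ (k + 1) * (I.zeta - x) := by
    intro k hk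
    rw [hInt_toSet hn, mem_Ico, not_and', not_le] at hk
    have := hk hx
    rw [lt_sub_comm, div_lt_iff₀' (by positivity)] at this
    exact this.le
  obtain ⟨K, hK, h1, h2, h3⟩ := exists_level_prod (f := fun k => stepFactor a b α I k x)
    (e := switchFactor a b α) (P := fun k => x ∈ (I.hInt k).toSet) ha1 hb
    (fun k => by unfold switchFactor; split_ifs <;> linarith)
    (fun k => fun h => child_subset hn0 _ (by omega) le_rfl h)
    (by
      intro k hk
      match k with
      | 0 =>
        have hI := hInt_subset hn I 0 hk
        have := hG 0
        simp only [gInt] at this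
        simp [stepFactor, redistribute, switchFactor, hα, this, hI]
      | k + 1 =>
        have hH := child_subset hn0 _ (by omega) le_rfl hk
        have hn' : x ∉ ((I.hInt (k + 1)).child 1).toSet := by
          simp only [hInt] at hk
          rw [child_toSet hn0] at hk ⊢
          intro h
          have h1 := hk.1
          have h2 := h.2
          have h3 : (2 : ℝ) ≤ n := by exact_mod_cast hn
          have h4 : 0 < (I.hInt (k + 1)).length / n := div_pos (length_pos hn0 _) hnp
          push_cast at h2
          nlinarith
        simp only [hInt] at hk
        simp only [stepFactor, switchFactor]
        split_ifs
        · rw [redistribute_of_notMem hn0 (by omega) (by omega) (hG k)]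
          simp [redistribute, hH, hn']
        · rw [redistribute_of_notMem hn0 (by omega) (by omega) (hG k)]
          simp [redistribute, hk])
    (by
      intro k
      match k with
      | 0 => exact redistribute_mem_Icc ha1 hb _ _ _
      | k + 1 =>
        simp only [stepFactor]
        split_ifs
        all_goals
          rw [redistribute_of_notMem hn0 (by omega) (by omega) (hG k), mul_one]
          exact redistribute_mem_Icc ha1 hb _ _ _)
    (by
      intro k hk
      simp only [stepFactor]
      split_ifs
      all_goals
        rw [redistribute_of_notMem hn0 (by omega) (by omega) (hG k),
          redistribute_of_notMem hn0 (by omega) (by omega) hk, one_mul]) (2 * α)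
  refine ⟨K, hK, h1.imp_right (hnot K), ?_, h3⟩
  match K with
  | 0 => exact Or.inl rfl
  | K + 1 =>
    right
    have := h2.resolve_left (by omega)
    rw [hInt_toSet hn] at this
    have := this.1
    rw [sub_le_comm, le_div_iff₀' (by positivity)] at this
    exact this

/-- The level of a point on the right of a point `c` very close to `zeta`. -/
theorem exists_level_right_of_close (hn : 2 ≤ n) {a b : ℝ} (ha : 0 < a) (ha1 : a ≤ 1) (hb : 1 ≤ b)
    {α : ℕ} (hα : 1 ≤ α) (I : NAdic n) {c x : ℝ} (hc : 0 < c - I.zeta)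
    (hc' : c - I.zeta ≤ ((n : ℝ) ^ (100 * α))⁻¹ * I.length) (hx : c < x) :
    ∃ K ≤ 2 * α, (K = 2 * α ∨ I.length ≤ n ^ (K + 2) * (x - c)) ∧
      (K = 0 ∨ n ^ K * (x - c) ≤ n * I.length) ∧
      a * ∏ k ∈ Finset.Icc 1 K, switchFactor b a α k ≤ localWeight a b α I x ∧
      localWeight a b α I x ≤ b * ∏ k ∈ Finset.Icc 1 K, switchFactor b a α k := by
  have hL := I.length_pos (by omega)
  have h2 : (2 : ℝ) ≤ n := by exact_mod_cast hn
  obtain ⟨K, hK, h3, h4, h5⟩ := exists_level_right hn ha ha1 hb hα I (x := x) (by linarith)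
  refine ⟨K, hK, h3.imp_right fun h => ?_, h4.imp_right fun h => ?_, h5⟩
  -- Since `K + 2 ≤ 100α`, replacing `zeta` by `c` costs at most `|I|` at this scale. The extra
  -- power of `n` absorbs it: `n|I| - |I| ≥ |I|`.
  · have h6 : (n : ℝ) ^ (K + 2) ≤ n ^ (100 * α) := pow_le_pow_right₀ (by linarith) (by omega)
    have h7 : (n : ℝ) ^ (K + 2) * (c - I.zeta) ≤ I.length := by
      rw [inv_mul_eq_div, le_div_iff₀' (by positivity)] at hc'
      exact (mul_le_mul_of_nonneg_right h6 hc.le).trans hc'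
    have h8 : (n : ℝ) ^ (K + 2) * (x - I.zeta) = n * (n ^ (K + 1) * (x - I.zeta)) := by ring
    have h9 : (n : ℝ) ^ (K + 2) * (x - c) =
      n ^ (K + 2) * (x - I.zeta) - n ^ (K + 2) * (c - I.zeta) := by ring
    nlinarith
  · have : (n : ℝ) ^ K * (x - c) ≤ n ^ K * (x - I.zeta) := by gcongr; linarith
    nlinarith

/-- The level of a point on the left of a point `c` very close to `zeta`. -/
theorem exists_level_left_of_close (hn : 2 ≤ n) {a b : ℝ} (ha : 0 < a) (ha1 : a ≤ 1) (hb : 1 ≤ b)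
    {α : ℕ} (hα : 1 ≤ α) (I : NAdic n) {c x : ℝ} (hc : 0 < c - I.zeta)
    (hc' : c - I.zeta ≤ ((n : ℝ) ^ (100 * α))⁻¹ * I.length) (hx : x < c) :
    ∃ K ≤ 2 * α, (K = 2 * α ∨ I.length ≤ n ^ (K + 2) * (c - x)) ∧
      (K = 0 ∨ n ^ K * (c - x) ≤ n * I.length) ∧
      a * ∏ k ∈ Finset.Icc 1 K, switchFactor a b α k ≤ localWeight a b α I x ∧
      localWeight a b α I x ≤ b * ∏ k ∈ Finset.Icc 1 K, switchFactor a b α k := by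
  have hL := I.length_pos (by omega)
  have h2 : (2 : ℝ) ≤ n := by exact_mod_cast hn
  rw [inv_mul_eq_div, le_div_iff₀' (by positivity)] at hc'
  have hcl : ∀ k ≤ 100 * α, (n : ℝ) ^ k * (c - I.zeta) ≤ I.length := fun k hk =>
    (mul_le_mul_of_nonneg_right (pow_le_pow_right₀ (by linarith) hk) hc.le).trans hc'
  rcases lt_or_ge x I.zeta with hxZ | hxZ
  · obtain ⟨K, hK, h3, h4, h5⟩ := exists_level_left hn ha ha1 hb hα I hxZ
    have h9 : ∀ k, (n : ℝ) ^ k * (c - x) = n ^ k * (I.zeta - x) + n ^ k * (c - I.zeta) :=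
      fun k => by ring
    refine ⟨K, hK, h3.imp_right fun h => ?_, h4.imp_right fun h => ?_, h5⟩
    · have h8 : (n : ℝ) ^ (K + 2) * (I.zeta - x) = n * (n ^ (K + 1) * (I.zeta - x)) := by ring
      have : 0 ≤ (n : ℝ) ^ (K + 2) * (c - I.zeta) := by positivity
      rw [h9]
      nlinarith
    · have := hcl K (by omega)
      rw [h9]
      nlinarith
  · obtain ⟨K, hK, h3, h4, h5⟩ := exists_level_right hn ha ha1 hb hα I hxZ
    -- A point between `zeta` and `c` is so close to `zeta` that it has the top level, where the
    -- profiles of both sides coincide.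
    have hK' : K = 2 * α := by
      by_contra hne
      have h6 := h3.resolve_left hne
      have h7 := hcl (K + 1) (by omega)
      have h8 : (n : ℝ) ^ (K + 1) * (x - I.zeta) < n ^ (K + 1) * (c - I.zeta) := by gcongr
      linarith
    subst hK'
    refine ⟨2 * α, le_rfl, Or.inl rfl, Or.inr ?_, ?_⟩
    · have h7 := hcl (2 * α) (by omega)
      have h8 : (n : ℝ) ^ (2 * α) * (c - x) ≤ n ^ (2 * α) * (c - I.zeta) := by gcongr
      nlinarith
    · rw [prod_switchFactor] at h5 ⊢
      rwa [mul_comm (a ^ α)]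

end NAdic

/-! ### Slow variation: from differences of levels to powers of ratios of distances. -/

theorem pow_le_mul_rpow_logb {q β t : ℝ} (hq : 1 < q) (hβ : 1 ≤ β) {d m : ℕ} (ht : 0 ≤ t)
    (h : q ^ d ≤ q ^ m * t) : β ^ d ≤ β ^ m * t ^ Real.logb q β := by
  have hs : 0 ≤ Real.logb q β := Real.logb_nonneg hq hβ
  have hβ' : ∀ k : ℕ, β ^ k = (q ^ k) ^ Real.logb q β := fun k => by
    rw [← Real.rpow_natCast q, ← Real.rpow_mul (by linarith), mul_comm,
      Real.rpow_mul (by linarith), Real.rpow_logb (by linarith) (by linarith) (by linarith),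
      Real.rpow_natCast]
  rw [hβ' d, hβ' m, ← Real.mul_rpow (by positivity) ht]
  exact Real.rpow_le_rpow (by positivity) h hs

/-- Two numbers `wx`, `wy` of levels `Kx`, `Ky` at distances `u ≤ v` from the center are
comparable, with constants growing like powers of `v / u`. -/
theorem le_mul_of_levels {q a b L u v wx wy : ℝ} (hq : 1 < q) (ha : 0 < a) (ha1 : a ≤ 1)
    (hb : 1 ≤ b) {e : ℕ → ℝ} (he : ∀ k, e k ∈ Icc a b) {N Kx Ky : ℕ} (hu : 0 < u)
    (huv : u ≤ v) (hxN : Kx ≤ N) (hyN : Ky ≤ N)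
    (hx1 : Kx = N ∨ L ≤ q ^ (Kx + 2) * u) (hx2 : Kx = 0 ∨ q ^ Kx * u ≤ q * L)
    (hx3 : a * ∏ k ∈ Finset.Icc 1 Kx, e k ≤ wx) (hx4 : wx ≤ b * ∏ k ∈ Finset.Icc 1 Kx, e k)
    (hy1 : Ky = N ∨ L ≤ q ^ (Ky + 2) * v) (hy2 : Ky = 0 ∨ q ^ Ky * v ≤ q * L)
    (hy3 : a * ∏ k ∈ Finset.Icc 1 Ky, e k ≤ wy) (hy4 : wy ≤ b * ∏ k ∈ Finset.Icc 1 Ky, e k) :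
    wx ≤ b ^ 4 * a⁻¹ ^ 4 * (v / u) ^ Real.logb q b * wy ∧
      wy ≤ b ^ 4 * a⁻¹ ^ 4 * (v / u) ^ Real.logb q a⁻¹ * wx := by
  have hg : 1 ≤ a⁻¹ := (one_le_inv₀ ha).2 ha1
  have hag : a⁻¹ * a = 1 := inv_mul_cancel₀ ha.ne'
  set g := a⁻¹
  set E : ℕ → ℝ := fun K => ∏ k ∈ Finset.Icc 1 K, e k with hE
  have hEpos : ∀ K, 0 < E K := fun K => Finset.prod_pos fun k _ => ha.trans_le (he k).1
  -- Raising the level by one multiplies `E` by a factor in `[a, b]`.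
  have hup : ∀ K d, E (K + d) ≤ b ^ d * E K ∧ E K ≤ g ^ d * E (K + d) := by
    intro K d
    induction d with
    | zero => simp
    | succ d ih =>
      have h1 : E (K + (d + 1)) = e (K + d + 1) * E (K + d) := by
        simp only [hE, ← add_assoc, Finset.prod_Icc_succ_top (Nat.le_add_left 1 (K + d))]
        ring
      obtain ⟨h2, h3⟩ := he (K + d + 1)
      rw [h1]
      constructor
      · calc _ ≤ b * (b ^ d * E K) := by gcongr; exacts [(hEpos _).le, ih.1]
          _ = _ := by ring
      · calc E K ≤ g ^ d * (g * a * E (K + d)) := by rw [hag, one_mul]; exact ih.2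
          _ ≤ g ^ d * (g * e (K + d + 1) * E (K + d)) := by
            gcongr; exact (hEpos _).le
          _ = _ := by ring
  have ht : 1 ≤ v / u := (one_le_div hu).2 huv
  have hq0 : 0 < q := by linarith
  have hv : 0 < v := by linarith
  have hts : 1 ≤ (v / u) ^ Real.logb q b := Real.one_le_rpow ht (Real.logb_nonneg hq hb)
  have htg : 1 ≤ (v / u) ^ Real.logb q g := Real.one_le_rpow ht (Real.logb_nonneg hq hg)
  have key : E Kx ≤ b ^ 3 * g ^ 3 * (v / u) ^ Real.logb q b * E Ky ∧
      E Ky ≤ b ^ 3 * g ^ 3 * (v / u) ^ Real.logb q g * E Kx := by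
    have hb3 : 1 ≤ b ^ 3 := one_le_pow₀ hb
    have hg3 : 1 ≤ g ^ 3 := one_le_pow₀ hg
    rcases lt_or_ge Ky Kx with hlt | hge
    · obtain ⟨d, rfl⟩ := Nat.exists_eq_add_of_le hlt.le
      have h1 := hx2.resolve_left (by omega)
      have h2 := hy1.resolve_left (by omega)
      -- The exponent `3` collects the slack of the level estimates: `2` from the lower bound on `v`
      -- and `1` from the upper bound on `u`.
      have h3 : q ^ d ≤ q ^ 3 * (v / u) := by
        rw [← mul_div_assoc, le_div_iff₀ hu]
        have : q ^ Ky * (q ^ d * u) ≤ q ^ Ky * (q ^ 3 * v) := by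
          calc _ = q ^ (Ky + d) * u := by ring
            _ ≤ q * L := h1
            _ ≤ q * (q ^ (Ky + 2) * v) := by gcongr
            _ = _ := by ring
        exact le_of_mul_le_mul_left this (by positivity)
      have hbd := pow_le_mul_rpow_logb hq hb (by positivity) h3
      have hgd := pow_le_mul_rpow_logb hq hg (by positivity) h3
      obtain ⟨h4, h5⟩ := hup Ky d
      constructor
      · refine h4.trans (mul_le_mul_of_nonneg_right (hbd.trans ?_) (hEpos _).le)
        rw [mul_right_comm]
        exact le_mul_of_one_le_right (by positivity) hg3
      · refine h5.trans (mul_le_mul_of_nonneg_right (hgd.trans ?_) (hEpos _).le)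
        rw [mul_assoc]
        exact le_mul_of_one_le_left (by positivity) hb3
    · obtain ⟨d, rfl⟩ := Nat.exists_eq_add_of_le hge
      -- The farther point can have the higher level only because of that slack.
      have h3 : d ≤ 3 := by
        rcases Nat.eq_zero_or_pos d with rfl | hd
        · omega
        have h1 := hx1.resolve_left (by omega)
        have h2 := hy2.resolve_left (by omega)
        have h3 : q ^ d ≤ q ^ 3 := by
          have : (q ^ Kx * u) * q ^ d ≤ (q ^ Kx * u) * q ^ 3 := by
            calc _ = q ^ (Kx + d) * u := by ring
              _ ≤ q ^ (Kx + d) * v := by gcongr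
              _ ≤ q * L := h2
              _ ≤ q * (q ^ (Kx + 2) * u) := by gcongr
              _ = _ := by ring
          exact le_of_mul_le_mul_left this (by positivity)
        exact (pow_le_pow_iff_right₀ hq).1 h3
      have hbd : b ^ d ≤ b ^ 3 := pow_le_pow_right₀ hb h3
      have hgd : g ^ d ≤ g ^ 3 := pow_le_pow_right₀ hg h3
      obtain ⟨h4, h5⟩ := hup Kx d
      constructor
      · refine h5.trans (mul_le_mul_of_nonneg_right (hgd.trans ?_) (hEpos _).le)
        rw [mul_right_comm]
        exact le_mul_of_one_le_left (by positivity) (one_le_mul_of_one_le_of_one_le hb3 hts)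
      · refine h4.trans (mul_le_mul_of_nonneg_right (hbd.trans ?_) (hEpos _).le)
        rw [mul_assoc]
        exact le_mul_of_one_le_right (by positivity) (one_le_mul_of_one_le_of_one_le hg3 htg)
  -- Passing between `E` and the weights costs one more `b` and one more `a⁻¹`, whence the fourth
  -- powers.
  have hE' : ∀ K w, a * E K ≤ w → E K ≤ g * w := fun K w h => by
    calc E K = g * (a * E K) := by rw [← mul_assoc, hag, one_mul]
      _ ≤ g * w := by gcongr
  constructor
  · calc wx ≤ b * (b ^ 3 * g ^ 3 * (v / u) ^ Real.logb q b * E Ky) :=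
          hx4.trans (by gcongr; exact key.1)
      _ ≤ b * (b ^ 3 * g ^ 3 * (v / u) ^ Real.logb q b * (g * wy)) := by
          gcongr; exact hE' _ _ hy3
      _ = _ := by ring
  · calc wy ≤ b * (b ^ 3 * g ^ 3 * (v / u) ^ Real.logb q g * E Kx) :=
          hy4.trans (by gcongr; exact key.2)
      _ ≤ b * (b ^ 3 * g ^ 3 * (v / u) ^ Real.logb q g * (g * wx)) := by
          gcongr; exact hE' _ _ hx3
      _ = _ := by ring

theorem switchFactor_mem_Icc {u v a b : ℝ} (hu : u ∈ Icc a b) (hv : v ∈ Icc a b) (α k : ℕ) :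
    switchFactor u v α k ∈ Icc a b := by
  unfold switchFactor
  split_ifs
  exacts [hu, hv]

namespace NAdic

variable {n : ℕ}

/-- Slow variation of the weight on either side of a point `c` close to `zeta`. -/
theorem localWeight_slow_variation (hn : 2 ≤ n) {a b : ℝ} (ha : 0 < a) (ha1 : a ≤ 1)
    (hb : 1 ≤ b) {α : ℕ} (hα : 1 ≤ α) (I : NAdic n) {c x y : ℝ} (hc : 0 < c - I.zeta)
    (hc' : c - I.zeta ≤ ((n : ℝ) ^ (100 * α))⁻¹ * I.length)
    (hxy : c < x ∧ x ≤ y ∨ y ≤ x ∧ x < c) :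
    localWeight a b α I x ≤
        b ^ 4 * a⁻¹ ^ 4 * ((y - c) / (x - c)) ^ Real.logb n b * localWeight a b α I y ∧
      localWeight a b α I y ≤
        b ^ 4 * a⁻¹ ^ 4 * ((y - c) / (x - c)) ^ Real.logb n a⁻¹ * localWeight a b α I x := by
  have hn1 : (1 : ℝ) < n := by exact_mod_cast hn
  have haI : a ∈ Icc a b := ⟨le_rfl, ha1.trans hb⟩
  have hbI : b ∈ Icc a b := ⟨ha1.trans hb, le_rfl⟩
  rcases hxy with ⟨h1, h2⟩ | ⟨h1, h2⟩
  · obtain ⟨Kx, hx, hx1, hx2, hx3, hx4⟩ :=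
      exists_level_right_of_close hn ha ha1 hb hα I hc hc' h1
    obtain ⟨Ky, hy, hy1, hy2, hy3, hy4⟩ :=
      exists_level_right_of_close hn ha ha1 hb hα I hc hc' (h1.trans_le h2)
    exact le_mul_of_levels hn1 ha ha1 hb (switchFactor_mem_Icc hbI haI α) (sub_pos.2 h1)
      (by linarith) hx hy hx1 hx2 hx3 hx4 hy1 hy2 hy3 hy4
  · obtain ⟨Kx, hx, hx1, hx2, hx3, hx4⟩ :=
      exists_level_left_of_close hn ha ha1 hb hα I hc hc' h2
    obtain ⟨Ky, hy, hy1, hy2, hy3, hy4⟩ :=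
      exists_level_left_of_close hn ha ha1 hb hα I hc hc' (h1.trans_lt h2)
    rw [← neg_div_neg_eq, neg_sub, neg_sub]
    exact le_mul_of_levels hn1 ha ha1 hb (switchFactor_mem_Icc haI hbI α) (sub_pos.2 h2)
      (by linarith) hx hy hx1 hx2 hx3 hx4 hy1 hy2 hy3 hy4

end NAdic

/-! ### Tameness on an interval and its integral consequences. -/

/-- The function `w` is comparable with the constant `F` on `[l, l + h)`, with constants that
deteriorate at most like powers of the distance to the boundary. -/
structure IsTameOn (w : ℝ → ℝ) (l h A s t F : ℝ) : Prop where
  upper : ∀ x ∈ Ioo l (l + h), w x ≤ A * (h / min (x - l) (l + h - x)) ^ s * F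
  lower : ∀ x ∈ Ioo l (l + h), F ≤ A * (h / min (x - l) (l + h - x)) ^ t * w x

theorem IsTameOn.congr {w w' : ℝ → ℝ} {l h A s t F : ℝ} (H : IsTameOn w l h A s t F)
    (hw : ∀ x ∈ Ioo l (l + h), w' x = w x) : IsTameOn w' l h A s t F :=
  ⟨fun x hx => by rw [hw x hx]; exact H.upper x hx,
    fun x hx => by rw [hw x hx]; exact H.lower x hx⟩

/-- The power singularities at the two endpoints have order `s * r < 1`; the minimum is handled by
adding both of them, which gives the factor `2`. -/
theorem IsTameOn.lintegral_rpow_le {w : ℝ → ℝ} {l h A s t F r : ℝ} (H : IsTameOn w l h A s t F)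
    (hw : ∀ x, 0 ≤ w x) (hh : 0 < h) (hA : 0 ≤ A) (hF : 0 ≤ F) (hr : 0 < r)
    (hsr : s * r < 1) :
    ∫⁻ x in Ico l (l + h), ENNReal.ofReal (w x ^ r) ≤
      ENNReal.ofReal (2 * A ^ r / (1 - s * r) * F ^ r * h) := by
  set σ := s * r with hσ
  set g : ℝ → ℝ := fun x => A ^ r * F ^ r * h ^ σ * ((x - l) ^ (-σ) + (l + h - x) ^ (-σ)) with hg
  have hi1 : IntervalIntegrable (fun x => (x - l) ^ (-σ)) volume l (l + h) := by
    have := (intervalIntegral.intervalIntegrable_rpow' (a := 0) (b := h) (r := -σ)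
      (by linarith)).comp_sub_right l
    simpa [add_comm] using this
  have hi2 : IntervalIntegrable (fun x => (l + h - x) ^ (-σ)) volume l (l + h) := by
    have := (intervalIntegral.intervalIntegrable_rpow' (a := h) (b := 0) (r := -σ)
      (by linarith)).comp_sub_left (l + h)
    simpa using this
  have hI : ∫ x in (0 : ℝ)..h, x ^ (-σ) = h ^ (1 - σ) / (1 - σ) := by
    rw [integral_rpow (Or.inl (by linarith)), Real.zero_rpow (by linarith)]
    ring_nf
  have hgI : ∫ x in l..(l + h), g x = 2 * A ^ r / (1 - σ) * F ^ r * h := by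
    have e1 : ∫ x in l..(l + h), (x - l) ^ (-σ) = h ^ (1 - σ) / (1 - σ) := by
      rw [intervalIntegral.integral_comp_sub_right (fun x => x ^ (-σ)) l, ← hI]
      simp
    have e2 : ∫ x in l..(l + h), (l + h - x) ^ (-σ) = h ^ (1 - σ) / (1 - σ) := by
      rw [intervalIntegral.integral_comp_sub_left (fun x => x ^ (-σ)) (l + h), ← hI]
      simp
    rw [hg, intervalIntegral.integral_const_mul, intervalIntegral.integral_add hi1 hi2, e1, e2]
    have : h ^ σ * h ^ (1 - σ) = h := by rw [← Real.rpow_add hh]; simp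
    calc _ = 2 * A ^ r / (1 - σ) * F ^ r * (h ^ σ * h ^ (1 - σ)) := by ring
      _ = _ := by rw [this]
  have hgi : IntervalIntegrable g volume l (l + h) := (hi1.add hi2).const_mul _
  have hg0 : ∀ x ∈ Ioc l (l + h), 0 ≤ g x := fun x hx => by
    have h1 : 0 ≤ x - l := by linarith [hx.1]
    have h2 : 0 ≤ l + h - x := by linarith [hx.2]
    positivity
  rw [← hgI, intervalIntegral.integral_of_le (by linarith),
    ofReal_integral_eq_lintegral_ofReal
      ((intervalIntegrable_iff_integrableOn_Ioc_of_le (by linarith)).1 hgi)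
      ((ae_restrict_iff' measurableSet_Ioc).2 (ae_of_all _ hg0)),
    restrict_Ico_eq_restrict_Ioc, ← restrict_Ioo_eq_restrict_Ioc]
  refine setLIntegral_mono' measurableSet_Ioo fun x hx => ENNReal.ofReal_le_ofReal ?_
  have h1 : 0 < x - l := by linarith [hx.1]
  have h2 : 0 < l + h - x := by linarith [hx.2]
  have hm : 0 < min (x - l) (l + h - x) := lt_min h1 h2
  calc w x ^ r ≤ (A * (h / min (x - l) (l + h - x)) ^ s * F) ^ r :=
        Real.rpow_le_rpow (hw x) (H.upper x hx) hr.le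
    _ = A ^ r * F ^ r * h ^ σ * min (x - l) (l + h - x) ^ (-σ) := by
        rw [Real.mul_rpow (by positivity) hF, Real.mul_rpow hA (by positivity),
          ← Real.rpow_mul (by positivity), Real.div_rpow hh.le hm.le, Real.rpow_neg hm.le]
        ring
    _ ≤ g x := by
        refine mul_le_mul_of_nonneg_left ?_ (by positivity)
        rcases min_choice (x - l) (l + h - x) with h3 | h3 <;> rw [h3]
        · exact le_add_of_nonneg_right (by positivity)
        · exact le_add_of_nonneg_left (by positivity)

/-- The middle half of the subinterval stays at distance at least `h / (4 * N)` from the boundary,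
so there `w` is bounded below by a fixed multiple of `F`. -/
theorem IsTameOn.le_lintegral {w : ℝ → ℝ} {l h A s t F N l' : ℝ} (H : IsTameOn w l h A s t F)
    (hw : ∀ x, 0 ≤ w x) (hh : 0 < h) (hA : 0 < A) (ht : 0 ≤ t) (hN : 0 < N)
    (hl : l ≤ l') (hl' : l' + h / N ≤ l + h) :
    ENNReal.ofReal ((A * (4 * N) ^ t * (2 * N))⁻¹ * F * h) ≤
      ∫⁻ x in Ico l' (l' + h / N), ENNReal.ofReal (w x) := by
  have hk : 0 < h / N := by positivity
  set k := h / N with hk_def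
  have hh' : h = N * k := by rw [hk_def]; field_simp
  calc ENNReal.ofReal ((A * (4 * N) ^ t * (2 * N))⁻¹ * F * h)
      = ENNReal.ofReal ((A * (4 * N) ^ t)⁻¹ * F) * ENNReal.ofReal (k / 2) := by
        rw [← ENNReal.ofReal_mul' (by positivity)]
        congr 1
        rw [hh']
        field_simp
    _ = ∫⁻ x in Ico (l' + k / 4) (l' + k * 3 / 4), ENNReal.ofReal ((A * (4 * N) ^ t)⁻¹ * F) := by
        rw [setLIntegral_const, Real.volume_Ico]
        congr 2
        ring
    _ ≤ ∫⁻ x in Ico (l' + k / 4) (l' + k * 3 / 4), ENNReal.ofReal (w x) := by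
        refine setLIntegral_mono' measurableSet_Ico fun x hx => ENNReal.ofReal_le_ofReal ?_
        rw [inv_mul_le_iff₀ (by positivity)]
        have h1 : k / 4 ≤ min (x - l) (l + h - x) :=
          le_min (by linarith [hx.1]) (by linarith [hx.2])
        refine (H.lower x ⟨by linarith [hx.1], by linarith [hx.2]⟩).trans ?_
        refine mul_le_mul_of_nonneg_right (mul_le_mul_of_nonneg_left ?_ hA.le) (hw x)
        refine Real.rpow_le_rpow ?_ ?_ ht
        · exact div_nonneg hh.le (le_trans (by positivity) h1)
        · rw [div_le_iff₀ (lt_of_lt_of_le (by positivity) h1)]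
          calc h = 4 * N * (k / 4) := by rw [hh']; ring
            _ ≤ _ := by gcongr
    _ ≤ _ := lintegral_mono_set (Ico_subset_Ico (by linarith) (by linarith))

namespace NAdic

variable {n : ℕ}

theorem localWeight_pos {a b : ℝ} (ha : 0 < a) (hb : 0 < b) (α : ℕ) (I : NAdic n) (x : ℝ) :
    0 < localWeight a b α I x := by
  have h : ∀ (K : NAdic n) j, 0 < redistribute a b K j x := fun K j => by
    unfold redistribute
    split_ifs <;> positivity
  refine Finset.prod_pos fun k _ => ?_
  match k with
  | 0 => exact one_pos
  | 1 => exact h _ _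
  | k + 2 =>
    simp only [stepFactor]
    split_ifs
    all_goals exact mul_pos (h _ _) (h _ _)

/-- The interval lies on one side of `c`, told by the sign of `m`, and `F` is the value at the
endpoint far from `c` (the near one may be `c` itself). The ratio of distances to `c` is largest
when the interval touches `c`, which yields the bound by `h` over the distance to the boundary. -/
theorem isTameOn_localWeight (hn : 2 ≤ n) {a b : ℝ} (ha : 0 < a) (ha1 : a ≤ 1)
    (hb : 1 ≤ b) {α : ℕ} (hα : 1 ≤ α) (I : NAdic n) {c : ℝ} (hc : 0 < c - I.zeta)
    (hc' : c - I.zeta ≤ ((n : ℝ) ^ (100 * α))⁻¹ * I.length) {l h : ℝ} (hh : 0 < h) {m : ℤ}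
    (hl : l = c + m * h) :
    IsTameOn (localWeight a b α I) l h (b ^ 4 * a⁻¹ ^ 4) (Real.logb n b) (Real.logb n a⁻¹)
      (localWeight a b α I (if 0 ≤ m then l + h else l)) := by
  have hn1 : (1 : ℝ) < n := by exact_mod_cast hn
  have hs : 0 ≤ Real.logb n b := Real.logb_nonneg hn1 hb
  have ht : 0 ≤ Real.logb n a⁻¹ := Real.logb_nonneg hn1 ((one_le_inv₀ ha).2 ha1)
  have hw : ∀ x, 0 ≤ localWeight a b α I x := fun x => (localWeight_pos ha (by linarith) α I x).le
  set y := if 0 ≤ m then l + h else l with hy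
  have key : ∀ x ∈ Ioo l (l + h), (c < x ∧ x ≤ y ∨ y ≤ x ∧ x < c) ∧ 0 ≤ (y - c) / (x - c) ∧
      (y - c) / (x - c) ≤ h / min (x - l) (l + h - x) := by
    intro x hx
    have h1 : 0 < x - l := by linarith [hx.1]
    have h2 : 0 < l + h - x := by linarith [hx.2]
    have hm : 0 < min (x - l) (l + h - x) := lt_min h1 h2
    rcases le_or_gt 0 m with h0 | h0
    · have h0' : (0 : ℝ) ≤ m := by exact_mod_cast h0
      have h3 : 0 ≤ m * h := by positivity
      rw [hy, if_pos h0]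
      refine ⟨Or.inl ⟨by linarith, by linarith⟩, div_nonneg (by linarith) (by linarith), ?_⟩
      refine le_trans ?_ (div_le_div_of_nonneg_left hh.le hm (min_le_left _ _))
      rw [div_le_div_iff₀ (by linarith) h1]
      have e1 : l + h - c = m * h + h := by rw [hl]; ring
      have e2 : x - c = m * h + (x - l) := by rw [hl]; ring
      rw [e1, e2]
      nlinarith [mul_nonneg h3 h2.le]
    · have h0' : (m : ℝ) + 1 ≤ 0 := by exact_mod_cast h0
      have h3 : 0 ≤ -(m + 1) * h := mul_nonneg (by linarith) hh.le
      rw [hy, if_neg (not_le.2 h0)]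
      refine ⟨Or.inr ⟨by linarith, by linarith⟩,
        div_nonneg_of_nonpos (by linarith) (by linarith), ?_⟩
      refine le_trans ?_ (div_le_div_of_nonneg_left hh.le hm (min_le_right _ _))
      rw [← neg_div_neg_eq, neg_sub, neg_sub, div_le_div_iff₀ (by linarith) h2]
      have e1 : c - l = -(m + 1) * h + h := by rw [hl]; ring
      have e2 : c - x = -(m + 1) * h + (l + h - x) := by rw [hl]; ring
      rw [e1, e2]
      nlinarith [mul_nonneg h3 h1.le]
  refine ⟨fun x hx => ?_, fun x hx => ?_⟩
  · obtain ⟨h1, h2, h3⟩ := key x hx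
    refine (localWeight_slow_variation hn ha ha1 hb hα I hc hc' h1).1.trans ?_
    have := Real.rpow_le_rpow h2 h3 hs
    have hwy := hw y
    gcongr
  · obtain ⟨h1, h2, h3⟩ := key x hx
    refine (localWeight_slow_variation hn ha ha1 hb hα I hc hc' h1).2.trans ?_
    have := Real.rpow_le_rpow h2 h3 ht
    have hwx := hw x
    gcongr

end NAdic

/-! ### Summing estimates over the disjoint sets `J ℓ`. -/

theorem setLIntegral_eq_add_tsum {f : ℝ → ℝ≥0∞} {J : ℕ → Set ℝ} {S : Set ℝ}
    (hJm : ∀ ℓ, MeasurableSet (J ℓ)) (hJd : Pairwise (Function.onFun Disjoint J))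
    (hS : MeasurableSet S) (hf : ∀ x ∉ ⋃ ℓ, J ℓ, f x = 1) :
    ∫⁻ x in S, f x = volume (S \ ⋃ ℓ, J ℓ) + ∑' ℓ, ∫⁻ x in S ∩ J ℓ, f x := by
  have hU : MeasurableSet (⋃ ℓ, J ℓ) := MeasurableSet.iUnion hJm
  rw [← lintegral_inter_add_sdiff f S hU, add_comm, inter_iUnion]
  congr 1
  · rw [setLIntegral_congr_fun (hS.diff hU) (fun x hx => hf x hx.2)]
    simp
  · exact lintegral_iUnion (fun ℓ => hS.inter (hJm ℓ))
      (fun i j hij => (hJd hij).mono inter_subset_right inter_subset_right) f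

theorem setLIntegral_le_of_forall {f : ℝ → ℝ≥0∞} {J : ℕ → Set ℝ} {S : Set ℝ}
    (hJm : ∀ ℓ, MeasurableSet (J ℓ)) (hJd : Pairwise (Function.onFun Disjoint J))
    (hS : MeasurableSet S) (hf : ∀ x ∉ ⋃ ℓ, J ℓ, f x = 1)
    (hJS : ∀ ℓ, J ℓ ⊆ S ∨ Disjoint (J ℓ) S)
    {M : ℝ≥0∞} (hM : 1 ≤ M)
    (h : ∀ ℓ, ∫⁻ x in J ℓ, f x ≤ M * volume (J ℓ)) : ∫⁻ x in S, f x ≤ M * volume S := by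
  rw [setLIntegral_eq_add_tsum hJm hJd hS hf, ← setLIntegral_one S,
    setLIntegral_eq_add_tsum (f := fun _ => 1) hJm hJd hS (fun _ _ => rfl), mul_add,
    ← ENNReal.tsum_mul_left]
  refine add_le_add (le_mul_of_one_le_left' hM) (ENNReal.tsum_le_tsum fun ℓ => ?_)
  rcases hJS ℓ with h1 | h1
  · simpa [inter_eq_self_of_subset_right h1] using h ℓ
  · simp [h1.symm.inter_eq]

theorem le_setLIntegral_of_forall {f : ℝ → ℝ≥0∞} {J : ℕ → Set ℝ} {S : Set ℝ}
    (hJm : ∀ ℓ, MeasurableSet (J ℓ)) (hJd : Pairwise (Function.onFun Disjoint J))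
    (hS : MeasurableSet S) (hf : ∀ x ∉ ⋃ ℓ, J ℓ, f x = 1)
    (hJS : ∀ ℓ, J ℓ ⊆ S ∨ Disjoint (J ℓ) S)
    {m : ℝ≥0∞} (hm : m ≤ 1)
    (h : ∀ ℓ, m * volume (J ℓ) ≤ ∫⁻ x in J ℓ, f x) : m * volume S ≤ ∫⁻ x in S, f x := by
  rw [setLIntegral_eq_add_tsum hJm hJd hS hf, ← setLIntegral_one S,
    setLIntegral_eq_add_tsum (f := fun _ => 1) hJm hJd hS (fun _ _ => rfl), mul_add,
    ← ENNReal.tsum_mul_left]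
  refine add_le_add (mul_le_of_le_one_left' hm) (ENNReal.tsum_le_tsum fun ℓ => ?_)
  rcases hJS ℓ with h1 | h1
  · simpa [inter_eq_self_of_subset_right h1] using h ℓ
  · simp [h1.symm.inter_eq]

theorem NAdic.volume_toSet {n : ℕ} (I : NAdic n) : volume I.toSet = ENNReal.ofReal I.length := by
  rw [NAdic.toSet, Real.volume_Ico, NAdic.length]

/-! ### The constructed weight on short intervals and around `Υ(J ℓ)`. -/

section Weight

variable {q : ℕ}

theorem constructedWeight_of_forall_notMem (a b : ℝ) {I : ℕ → NAdic q} (α : ℕ → ℕ) {x : ℝ}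
    (hx : ∀ ℓ, x ∉ (I ℓ).toSet) : constructedWeight a b I α x = 1 := by
  rw [constructedWeight, dif_neg]
  push Not
  exact hx

theorem constructedWeight_nonneg {a b : ℝ} (ha : 0 < a) (hb : 0 < b) (I : ℕ → NAdic q)
    (α : ℕ → ℕ) (x : ℝ) : 0 ≤ constructedWeight a b I α x := by
  unfold constructedWeight
  split_ifs
  exacts [(NAdic.localWeight_pos ha hb _ _ _).le, zero_le_one]

end Weight

namespace IsSelection

variable {p q : ℕ} {I : ℕ → NAdic q} {J : ℕ → NAdic p} {α : ℕ → ℕ}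

/-- Disjointness of the `J ℓ` makes the chosen index unique, and the formula extends from `I ℓ` to
`J ℓ` because the local weight is `1` off `I ℓ`. -/
theorem constructedWeight_of_mem (H : IsSelection p q I J α) (hq : 2 ≤ q) (a b : ℝ) {ℓ : ℕ}
    {x : ℝ} (hx : x ∈ (J ℓ).toSet) :
    constructedWeight a b I α x = NAdic.localWeight a b (α ℓ) (I ℓ) x := by
  have huniq : ∀ k, x ∈ (I k).toSet → k = ℓ := fun k hk => by
    by_contra hne
    exact Set.disjoint_left.1 (H.disjoint k ℓ hne) (H.subset k hk) hx
  by_cases hI : ∃ k, x ∈ (I k).toSet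
  · rw [constructedWeight, dif_pos hI, huniq _ hI.choose_spec]
  · push Not at hI
    rw [constructedWeight_of_forall_notMem a b α hI,
      NAdic.localWeight_of_notMem hq a b (α ℓ) (I ℓ) (hI ℓ)]

theorem constructedWeight_of_notMem (H : IsSelection p q I J α) (a b : ℝ) {x : ℝ}
    (hx : x ∉ ⋃ ℓ, (J ℓ).toSet) : constructedWeight a b I α x = 1 :=
  constructedWeight_of_forall_notMem a b α fun ℓ hℓ => hx (mem_iUnion.2 ⟨ℓ, H.subset ℓ hℓ⟩)

theorem measurable_constructedWeight (H : IsSelection p q I J α) (hq : 2 ≤ q) (a b : ℝ) :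
    Measurable (constructedWeight a b I α) := by
  intro s hs
  have : constructedWeight a b I α ⁻¹' s =
      (⋃ ℓ, (J ℓ).toSet ∩ NAdic.localWeight a b (α ℓ) (I ℓ) ⁻¹' s) ∪
        ((⋃ ℓ, (J ℓ).toSet)ᶜ ∩ (fun _ => (1 : ℝ)) ⁻¹' s) := by
    ext x
    by_cases hx : x ∈ ⋃ ℓ, (J ℓ).toSet
    · obtain ⟨ℓ, hℓ⟩ := mem_iUnion.1 hx
      simp only [mem_union, mem_inter_iff, mem_compl_iff, hx, not_true, false_and, or_false,
        mem_iUnion, mem_preimage]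
      constructor
      · exact fun h => ⟨ℓ, hℓ, by rwa [← H.constructedWeight_of_mem hq a b hℓ]⟩
      · rintro ⟨k, hk, h⟩
        rwa [H.constructedWeight_of_mem hq a b hk]
    · have h := hx
      simp only [mem_iUnion, not_exists] at h
      simp [h, H.constructedWeight_of_notMem a b hx]
  rw [this]
  refine .union (.iUnion fun ℓ => (NAdic.measurableSet_toSet _).inter
    (NAdic.measurable_localWeight a b _ _ hs)) (.inter (.compl (.iUnion fun ℓ =>
      NAdic.measurableSet_toSet _)) (measurable_const hs))

theorem length_le (H : IsSelection p q I J α) (hq : q ≠ 0) (ℓ : ℕ) :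
    (I ℓ).length ≤ (J ℓ).length := by
  have h := H.subset ℓ
  rw [NAdic.toSet_eq, NAdic.toSet_eq,
    Ico_subset_Ico_iff (by linarith [(I ℓ).length_pos hq])] at h
  linarith [h.1, h.2]

/-- The constructed weight is tame on every short `p`-adic interval inside a `J ℓ`. -/
theorem exists_isTameOn (H : IsSelection p q I J α) (hp : p ≠ 0) (hq : 2 ≤ q) {a b : ℝ}
    (ha : 0 < a) (ha1 : a ≤ 1) (hb : 1 ≤ b) {ℓ : ℕ} {Q : NAdic p} (hQ : (J ℓ).gen < Q.gen)
    (hQJ : Q.toSet ⊆ (J ℓ).toSet) :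
    ∃ F, 0 < F ∧ IsTameOn (constructedWeight a b I α) Q.left Q.length (b ^ 4 * a⁻¹ ^ 4)
      (Real.logb q b) (Real.logb q a⁻¹) F := by
  obtain ⟨m, hm⟩ := NAdic.exists_left_eq_upsilon_add hp hQ
  refine ⟨_, NAdic.localWeight_pos ha (by linarith) (α ℓ) (I ℓ) _,
    (NAdic.isTameOn_localWeight hq ha ha1 hb (H.one_le_alpha ℓ) (I ℓ) (H.zeta_lt ℓ) (H.close ℓ)
      (Q.length_pos hp) hm).congr fun x hx => H.constructedWeight_of_mem hq a b (hQJ ?_)⟩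
  rw [NAdic.toSet_eq]
  exact Ioo_subset_Ico_self hx

/-- The far endpoint lies to the right of `I ℓ`, so the reference value is `1`. The interval leaves
`J ℓ`, hence the local weight in place of the constructed one. -/
theorem isTameOn_right (H : IsSelection p q I J α) (hp : p ≠ 0) (hq : 2 ≤ q) {a b : ℝ}
    (ha : 0 < a) (ha1 : a ≤ 1) (hb : 1 ≤ b) (ℓ : ℕ) :
    IsTameOn (NAdic.localWeight a b (α ℓ) (I ℓ)) (J ℓ).upsilon (J ℓ).length (b ^ 4 * a⁻¹ ^ 4)
      (Real.logb q b) (Real.logb q a⁻¹) 1 := by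
  have h := NAdic.isTameOn_localWeight hq ha ha1 hb (H.one_le_alpha ℓ) (I ℓ) (H.zeta_lt ℓ)
    (H.close ℓ) ((J ℓ).length_pos hp) (l := (J ℓ).upsilon) (m := 0) (by simp)
  rwa [if_pos le_rfl, NAdic.localWeight_of_notMem hq] at h
  rw [NAdic.toSet_eq]
  intro hx
  have h1 := H.zeta_lt ℓ
  have h2 := hx.2
  have h3 := H.length_le (by omega) ℓ
  rw [NAdic.zeta_eq (by omega)] at h1
  have h4 : (I ℓ).length / q ≤ (I ℓ).length :=
    div_le_self ((I ℓ).length_pos (by omega)).le (by norm_cast; omega)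
  linarith

/-- Here the far endpoint lies to the left of `I ℓ` because `Υ(J ℓ)` exceeds `zeta` by less than `|I
ℓ| / q`. -/
theorem isTameOn_left (H : IsSelection p q I J α) (hp : p ≠ 0) (hq : 2 ≤ q) {a b : ℝ}
    (ha : 0 < a) (ha1 : a ≤ 1) (hb : 1 ≤ b) (ℓ : ℕ) :
    IsTameOn (NAdic.localWeight a b (α ℓ) (I ℓ)) ((J ℓ).upsilon - (J ℓ).length) (J ℓ).length
      (b ^ 4 * a⁻¹ ^ 4) (Real.logb q b) (Real.logb q a⁻¹) 1 := by
  have h := NAdic.isTameOn_localWeight hq ha ha1 hb (H.one_le_alpha ℓ) (I ℓ) (H.zeta_lt ℓ)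
    (H.close ℓ) ((J ℓ).length_pos hp) (l := (J ℓ).upsilon - (J ℓ).length) (m := -1)
    (by push_cast; ring)
  rwa [if_neg (by norm_num), NAdic.localWeight_of_notMem hq] at h
  rw [NAdic.toSet_eq]
  intro hx
  have h1 := H.close ℓ
  have h2 := hx.1
  have h3 := H.length_le (by omega) ℓ
  rw [NAdic.zeta_eq (by omega)] at h1
  have hL := (I ℓ).length_pos (n := q) (by omega)
  have hq2 : (2 : ℝ) ≤ q := by exact_mod_cast hq
  have h5 : ((q : ℝ) ^ (100 * α ℓ))⁻¹ * (I ℓ).length < (I ℓ).length / q := by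
    rw [inv_mul_eq_div]
    refine div_lt_div_of_pos_left hL (by positivity) ?_
    have := H.one_le_alpha ℓ
    exact lt_self_pow₀ (by linarith) (by omega)
  linarith

end IsSelection

/-! ### Uniform bounds on all `p`-adic intervals. -/

namespace IsSelection

variable {p q : ℕ} {I : ℕ → NAdic q} {J : ℕ → NAdic p} {α : ℕ → ℕ}

/-- `J ℓ` is covered by the two intervals of length `|J ℓ|` flanking `Υ(J ℓ)`, both tame with
reference value `1`. -/
theorem lintegral_rpow_le (H : IsSelection p q I J α) (hp : p ≠ 0) (hq : 2 ≤ q) {a b : ℝ}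
    (ha : 0 < a) (ha1 : a ≤ 1) (hb : 1 ≤ b) {r : ℝ} (hr : 0 < r)
    (hsr : Real.logb q b * r < 1) (ℓ : ℕ) :
    ∫⁻ x in (J ℓ).toSet, ENNReal.ofReal (constructedWeight a b I α x ^ r) ≤
      ENNReal.ofReal (2 * (2 * (b ^ 4 * a⁻¹ ^ 4) ^ r / (1 - Real.logb q b * r))) *
        volume (J ℓ).toSet := by
  have hJ := (J ℓ).length_pos hp
  have hb0 : 0 < b := by linarith
  have hw := fun x => (NAdic.localWeight_pos ha hb0 (α ℓ) (I ℓ) x).le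
  have hC : 0 ≤ 2 * (b ^ 4 * a⁻¹ ^ 4) ^ r / (1 - Real.logb q b * r) :=
    div_nonneg (by positivity) (by linarith)
  have h1 := (H.isTameOn_left hp hq ha ha1 hb ℓ).lintegral_rpow_le hw hJ (by positivity)
    zero_le_one hr hsr
  have h2 := (H.isTameOn_right hp hq ha ha1 hb ℓ).lintegral_rpow_le hw hJ (by positivity)
    zero_le_one hr hsr
  rw [Real.one_rpow, mul_one, sub_add_cancel] at h1
  rw [Real.one_rpow, mul_one] at h2
  have hsub : (J ℓ).toSet ⊆ Ico ((J ℓ).upsilon - (J ℓ).length) (J ℓ).upsilon ∪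
      Ico (J ℓ).upsilon ((J ℓ).upsilon + (J ℓ).length) := by
    have h3 : (J ℓ).length / p ≤ (J ℓ).length :=
      div_le_self hJ.le (by norm_cast; omega)
    have h4 : 0 ≤ (J ℓ).length / p := by positivity
    rw [Ico_union_Ico_eq_Ico (by linarith) (by linarith), NAdic.toSet_eq,
      NAdic.upsilon_eq hp]
    exact Ico_subset_Ico (by linarith) (by linarith)
  calc ∫⁻ x in (J ℓ).toSet, ENNReal.ofReal (constructedWeight a b I α x ^ r)
      = ∫⁻ x in (J ℓ).toSet, ENNReal.ofReal (NAdic.localWeight a b (α ℓ) (I ℓ) x ^ r) :=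
        setLIntegral_congr_fun (NAdic.measurableSet_toSet _) fun x hx => by
          simp only [H.constructedWeight_of_mem hq a b hx]
    _ ≤ _ := (lintegral_mono_set hsub).trans (lintegral_union_le _ _ _)
    _ ≤ _ := add_le_add h1 h2
    _ = _ := by
        rw [NAdic.volume_toSet, ← ENNReal.ofReal_add (by positivity) (by positivity),
          ← ENNReal.ofReal_mul (by positivity)]
        congr 1
        ring

/-- This serves for children of `J ℓ`: each lies in one of the two flanking intervals, so its mass
is compared with `|J ℓ|` itself and not with a local value `F`. -/
theorem le_lintegral_of_length_eq (H : IsSelection p q I J α) (hp : p ≠ 0) (hq : 2 ≤ q) {a b : ℝ}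
    (ha : 0 < a) (ha1 : a ≤ 1) (hb : 1 ≤ b) {ℓ : ℕ} {Q : NAdic p} (hQJ : Q.toSet ⊆ (J ℓ).toSet)
    (hQ : (J ℓ).gen < Q.gen) (hlen : Q.length = (J ℓ).length / p) :
    ENNReal.ofReal ((b ^ 4 * a⁻¹ ^ 4 * (4 * p) ^ Real.logb q a⁻¹ * (2 * p))⁻¹ *
      (J ℓ).length) ≤ ∫⁻ x in Q.toSet, ENNReal.ofReal (constructedWeight a b I α x) := by
  have hJ := (J ℓ).length_pos hp
  have hb0 : 0 < b := by linarith
  have hw := fun x => (NAdic.localWeight_pos ha hb0 (α ℓ) (I ℓ) x).le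
  have ht : 0 ≤ Real.logb q a⁻¹ :=
    Real.logb_nonneg (by exact_mod_cast hq) ((one_le_inv₀ ha).2 ha1)
  obtain ⟨m, hm⟩ := NAdic.exists_left_eq_upsilon_add hp hQ
  have hh : 0 < (J ℓ).length / p := by positivity
  have hh' : (J ℓ).length / p ≤ (J ℓ).length := div_le_self hJ.le (by norm_cast; omega)
  have hsub := hQJ
  rw [NAdic.toSet_eq, NAdic.toSet_eq, Ico_subset_Ico_iff (by linarith)] at hsub
  have hc := (J ℓ).upsilon_eq hp
  have hp0 : (0 : ℝ) < p := by positivity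
  have key : ENNReal.ofReal ((b ^ 4 * a⁻¹ ^ 4 * (4 * p) ^ Real.logb q a⁻¹ * (2 * p))⁻¹ * 1 *
      (J ℓ).length) ≤ ∫⁻ x in Ico Q.left (Q.left + (J ℓ).length / p),
        ENNReal.ofReal (NAdic.localWeight a b (α ℓ) (I ℓ) x) := by
    rcases le_or_gt 0 m with h0 | h0
    · have h0' : (0 : ℝ) ≤ m := by exact_mod_cast h0
      have h3 : 0 ≤ m * Q.length := mul_nonneg h0' (by linarith)
      exact (H.isTameOn_right hp hq ha ha1 hb ℓ).le_lintegral hw hJ (by positivity) ht hp0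
        (by linarith) (by linarith)
    · have h0' : (m : ℝ) + 1 ≤ 0 := by exact_mod_cast h0
      have h3 : 0 ≤ -(m + 1) * Q.length := mul_nonneg (by linarith) (by linarith)
      exact (H.isTameOn_left hp hq ha ha1 hb ℓ).le_lintegral hw hJ (by positivity) ht hp0
        (by linarith) (by linarith)
  rw [mul_one, ← hlen, ← NAdic.toSet_eq] at key
  refine key.trans_eq (setLIntegral_congr_fun (NAdic.measurableSet_toSet _) fun x hx => ?_)
  simp only [H.constructedWeight_of_mem hq a b (hQJ hx)]

/-- Uniform bounds for the integrals of the weight and of its `r`-th power. -/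
theorem exists_bounds (H : IsSelection p q I J α) (hp : p ≠ 0) (hq : 2 ≤ q) {a b : ℝ}
    (ha : 0 < a) (ha1 : a ≤ 1) (hb : 1 ≤ b) {r : ℝ} (hr : 1 ≤ r)
    (hsr : Real.logb q b * r < 1) :
    ∃ C ε : ℝ, 0 < C ∧ 0 < ε ∧ ∀ Q : NAdic p, ∃ F, 0 < F ∧
      ∫⁻ x in Q.toSet, ENNReal.ofReal (constructedWeight a b I α x ^ r) ≤
        ENNReal.ofReal (C * F ^ r * Q.length) ∧
      ∫⁻ x in Q.toSet, ENNReal.ofReal (constructedWeight a b I α x) ≤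
        ENNReal.ofReal (C * F * Q.length) ∧
      ∀ i, 1 ≤ i → i ≤ p → ENNReal.ofReal (ε * F * Q.length) ≤
        ∫⁻ x in (Q.child i).toSet, ENNReal.ofReal (constructedWeight a b I α x) := by
  have hb0 : 0 < b := by linarith
  have hp0 : (0 : ℝ) < p := by positivity
  have hp1 : (1 : ℝ) ≤ p := by norm_cast; omega
  have hq1 : (1 : ℝ) < q := by exact_mod_cast hq
  have hs : 0 ≤ Real.logb q b := Real.logb_nonneg hq1 hb
  have hg : 1 ≤ a⁻¹ := (one_le_inv₀ ha).2 ha1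
  have ht : 0 ≤ Real.logb q a⁻¹ := Real.logb_nonneg hq1 hg
  have hs1 : Real.logb q b * 1 < 1 := by nlinarith
  have hw := constructedWeight_nonneg ha hb0 I α
  set w := constructedWeight a b I α with hw_def
  set A := b ^ 4 * a⁻¹ ^ 4 with hA
  have hA1 : 1 ≤ A := one_le_mul_of_one_le_of_one_le (one_le_pow₀ hb) (one_le_pow₀ hg)
  have hA0 : 0 < A := by linarith
  set B : ℝ → ℝ := fun ρ => 2 * A ^ ρ / (1 - Real.logb q b * ρ) with hB
  have hBr : 0 ≤ B r := div_nonneg (by positivity) (by linarith)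
  have hB1 : 0 ≤ B 1 := div_nonneg (by positivity) (by linarith)
  set δ := (A * (4 * p) ^ Real.logb q a⁻¹ * (2 * p))⁻¹ with hδ
  have hδ0 : 0 < δ := by positivity
  have hδ1 : δ ≤ 1 := by
    refine inv_le_one_of_one_le₀ (one_le_mul_of_one_le_of_one_le
      (one_le_mul_of_one_le_of_one_le hA1 (Real.one_le_rpow (by linarith) ht)) (by linarith))
  have hJm : ∀ ℓ, MeasurableSet (J ℓ).toSet := fun ℓ => NAdic.measurableSet_toSet _
  have hJd : Pairwise (Function.onFun Disjoint fun ℓ => (J ℓ).toSet) :=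
    fun k ℓ hkl => H.disjoint k ℓ hkl
  have hr0 : 0 < r := by linarith
  -- the two alternatives for a `p`-adic interval
  have halt : ∀ Q : NAdic p, (∃ ℓ, (J ℓ).gen < Q.gen ∧ Q.toSet ⊆ (J ℓ).toSet) ∨
      ∀ ℓ, (J ℓ).toSet ⊆ Q.toSet ∨ Disjoint (J ℓ).toSet Q.toSet := by
    intro Q
    by_cases h : ∃ ℓ, (J ℓ).gen < Q.gen ∧ Q.toSet ⊆ (J ℓ).toSet
    · exact Or.inl h
    · refine Or.inr fun ℓ => ?_
      rcases le_or_gt Q.gen (J ℓ).gen with h1 | h1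
      · exact NAdic.subset_or_disjoint hp h1
      · right
        exact ((NAdic.subset_or_disjoint hp h1.le).resolve_left fun h2 => h ⟨ℓ, h1, h2⟩).symm
  -- The first constant dominates the upper bounds of both alternatives and both exponents. In the
  -- second, `p` accounts for the length `|Q| / p` of a child.
  refine ⟨B r + B 1 + 2 * B r + 2 * B 1 + 1, δ / p, by positivity, by positivity, fun Q => ?_⟩
  have hQ := Q.length_pos hp
  have hδp : δ / p ≤ δ := div_le_self hδ0.le hp1
  rcases halt Q with ⟨ℓ, hℓ, hQJ⟩ | hQJ
  · obtain ⟨F, hF, hT⟩ := H.exists_isTameOn hp hq ha ha1 hb hℓ hQJ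
    have h1 := hT.lintegral_rpow_le hw hQ hA0.le hF.le hr0 hsr
    have h2 := hT.lintegral_rpow_le hw hQ hA0.le hF.le one_pos hs1
    simp only [Real.rpow_one F, Real.rpow_one (_ : ℝ)] at h2
    rw [← NAdic.toSet_eq] at h1 h2
    refine ⟨F, hF, h1.trans (ENNReal.ofReal_le_ofReal ?_),
      h2.trans (ENNReal.ofReal_le_ofReal ?_), fun i hi hip => ?_⟩
    · gcongr
      show B r ≤ _
      linarith
    · gcongr
      have : B 1 = 2 * A / (1 - Real.logb q b * 1) := by simp [hB]
      linarith
    · have hi1 : (1 : ℝ) ≤ i := by exact_mod_cast hi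
      have hi2 : (i : ℝ) ≤ p := by exact_mod_cast hip
      have h4 : 0 < Q.length / p := by positivity
      have h5 : (p : ℝ) * (Q.length / p) = Q.length := by field_simp
      have h3 := hT.le_lintegral hw hQ hA0 ht hp0 (l' := (Q.child i).left)
        (by rw [NAdic.child_left' hp]; nlinarith) (by rw [NAdic.child_left' hp]; nlinarith)
      rw [← NAdic.child_length hp Q i, ← NAdic.toSet_eq] at h3
      refine le_trans (ENNReal.ofReal_le_ofReal ?_) h3
      gcongr
  · have hup : ∀ ρ, 0 < ρ → Real.logb q b * ρ < 1 → 0 ≤ B ρ →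
        ∫⁻ x in Q.toSet, ENNReal.ofReal (w x ^ ρ) ≤
          ENNReal.ofReal (max 1 (2 * B ρ)) * volume Q.toSet := fun ρ hρ hsρ hBρ => by
      refine setLIntegral_le_of_forall hJm hJd Q.measurableSet_toSet (fun x hx => ?_) hQJ
        (by rw [ENNReal.one_le_ofReal]; exact le_max_left _ _) fun ℓ => ?_
      · rw [hw_def, H.constructedWeight_of_notMem a b hx, Real.one_rpow, ENNReal.ofReal_one]
      · refine (H.lintegral_rpow_le hp hq ha ha1 hb hρ hsρ ℓ).trans ?_
        gcongr
        exact le_max_right _ _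
    have h1 := hup r hr0 hsr hBr
    have h2 := hup 1 one_pos hs1 hB1
    simp only [Real.rpow_one] at h2
    rw [NAdic.volume_toSet, ← ENNReal.ofReal_mul (by positivity)] at h1 h2
    refine ⟨1, one_pos, h1.trans (ENNReal.ofReal_le_ofReal ?_),
      h2.trans (ENNReal.ofReal_le_ofReal ?_), fun i hi hip => ?_⟩
    · rw [Real.one_rpow, mul_one]
      gcongr
      exact max_le (by linarith) (by linarith)
    · rw [mul_one]
      gcongr
      exact max_le (by linarith) (by linarith)
    · have hsubQ := NAdic.child_subset hp Q hi hip
      rw [mul_one]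
      rcases halt (Q.child i) with ⟨ℓ, hℓ, hQJ'⟩ | hQJ'
      -- The child is strictly shorter than `J ℓ` and inside it, while `J ℓ ⊆ Q`. This forces `Q`
      -- and `J ℓ` to have the same length.
      · have hmem : (Q.child i).left ∈ (Q.child i).toSet := by
          rw [NAdic.toSet_eq]
          exact left_mem_Ico.2 (by linarith [(Q.child i).length_pos hp])
        have h3 := (hQJ ℓ).resolve_right
          (Set.not_disjoint_iff.2 ⟨_, hQJ' hmem, hsubQ hmem⟩)
        have hgen : (J ℓ).gen ≤ Q.gen := by
          have : (Q.child i).gen = Q.gen + 1 := rfl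
          omega
        have hlen : Q.length ≤ (J ℓ).length := by
          obtain ⟨d, hd⟩ := NAdic.exists_length_eq_mul hp hgen
          have hJ := (J ℓ).length_pos hp
          have : d ≠ 0 := by
            rintro rfl
            simp [hd] at hJ
          have : (1 : ℝ) ≤ d := by norm_cast; omega
          nlinarith
        have hlen' : (J ℓ).length ≤ Q.length := by
          rw [NAdic.toSet_eq, NAdic.toSet_eq,
            Ico_subset_Ico_iff (by linarith [(J ℓ).length_pos hp])] at h3
          linarith [h3.1, h3.2]
        refine le_trans (ENNReal.ofReal_le_ofReal ?_)
          (H.le_lintegral_of_length_eq hp hq ha ha1 hb hQJ' hℓ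
            (by rw [NAdic.child_length hp, hlen.antisymm hlen']))
        gcongr
      · have h3 : ENNReal.ofReal δ * volume (Q.child i).toSet ≤
            ∫⁻ x in (Q.child i).toSet, ENNReal.ofReal (w x) := by
          refine le_setLIntegral_of_forall hJm hJd (NAdic.measurableSet_toSet _) (fun x hx => ?_)
            hQJ' (by rw [ENNReal.ofReal_le_one]; exact hδ1) fun ℓ => ?_
          · rw [hw_def, H.constructedWeight_of_notMem a b hx, ENNReal.ofReal_one]
          · rw [NAdic.volume_toSet, ← ENNReal.ofReal_mul hδ0.le]
            have h4 := NAdic.child_subset hp (J ℓ) le_rfl (by omega)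
            exact (H.le_lintegral_of_length_eq hp hq ha ha1 hb h4 (Int.lt_succ _)
              (NAdic.child_length hp _ _)).trans
                (lintegral_mono_set h4)
        rw [NAdic.volume_toSet, ← ENNReal.ofReal_mul hδ0.le, NAdic.child_length hp] at h3
        convert h3 using 2
        ring

end IsSelection

/-! ### From uniform bounds to the reverse Hölder class. -/

theorem locallyIntegrable_of_forall_nAdic {n : ℕ} (hn : 2 ≤ n) {w : ℝ → ℝ}
    (hw : ∀ Q : NAdic n, IntegrableOn w Q.toSet volume) : LocallyIntegrable w volume := by
  intro x
  obtain ⟨m, hm⟩ := pow_unbounded_of_one_lt |x| (show (1 : ℝ) < n by exact_mod_cast hn)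
  obtain ⟨h1, h2⟩ := abs_lt.1 hm
  -- No `n`-adic interval has `0` in its interior, so `[-n^m, 0)` and `[0, n^m)` are both needed.
  have h3 := (hw ⟨-m, 0⟩).union (hw ⟨-m, 1⟩)
  refine ⟨Ioo (-(n : ℝ) ^ m) (n ^ m), Ioo_mem_nhds h1 h2, h3.mono_set ?_⟩
  simp only [NAdic.toSet, NAdic.left, NAdic.right, zpow_neg, zpow_natCast, div_inv_eq_mul]
  push_cast
  rw [zero_mul, sub_self, zero_mul, Ico_union_Ico_eq_Ico (by linarith [abs_nonneg x])
    (by linarith [abs_nonneg x])]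
  simpa using Ioo_subset_Ico_self

/-- Membership in the reverse Hölder class from uniform bounds with reference values `F`. -/
theorem mem_RHAdic_of_bounds {n : ℕ} (hn : 2 ≤ n) {w : ℝ → ℝ} (hw : ∀ x, 0 ≤ w x)
    (hwm : Measurable w) {r C ε : ℝ} (hr : 0 < r) (hC : 0 < C) (hε : 0 < ε)
    (H : ∀ Q : NAdic n, ∃ F, 0 < F ∧
      ∫⁻ x in Q.toSet, ENNReal.ofReal (w x ^ r) ≤ ENNReal.ofReal (C * F ^ r * Q.length) ∧
      ∫⁻ x in Q.toSet, ENNReal.ofReal (w x) ≤ ENNReal.ofReal (C * F * Q.length) ∧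
      ∀ i, 1 ≤ i → i ≤ n → ENNReal.ofReal (ε * F * Q.length) ≤
        ∫⁻ x in (Q.child i).toSet, ENNReal.ofReal (w x)) : w ∈ RHAdic n r := by
  have hn0 : n ≠ 0 := by omega
  have hint : ∀ Q : NAdic n, IntegrableOn w Q.toSet volume := fun Q => by
    obtain ⟨F, -, -, h, -⟩ := H Q
    refine ⟨hwm.aestronglyMeasurable, ?_⟩
    rw [hasFiniteIntegral_iff_ofReal (ae_of_all _ hw)]
    exact h.trans_lt ENNReal.ofReal_lt_top
  have hwr : ∀ x, 0 ≤ w x ^ r := fun x => Real.rpow_nonneg (hw x) r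
  have hwrm : Measurable fun x => w x ^ r := hwm.pow_const r
  refine ⟨⟨hw, locallyIntegrable_of_forall_nAdic hn hint⟩, fun Q => ?_,
    ⟨C ^ (1 / r) / ε, fun Q => ?_⟩, ?_⟩
  · obtain ⟨F, -, h, -⟩ := H Q
    refine ⟨hwrm.aestronglyMeasurable, ?_⟩
    rw [hasFiniteIntegral_iff_ofReal (ae_of_all _ hwr)]
    exact h.trans_lt ENNReal.ofReal_lt_top
  · obtain ⟨F, hF, h1, -, h3⟩ := H Q
    have hQ := Q.length_pos hn0
    have hvol : volume.real Q.toSet = Q.length := by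
      rw [measureReal_def, NAdic.volume_toSet, ENNReal.toReal_ofReal hQ.le]
    have h4 : ∫ x in Q.toSet, w x ^ r ≤ C * F ^ r * Q.length := by
      rw [integral_eq_lintegral_of_nonneg_ae (ae_of_all _ hwr) hwrm.aestronglyMeasurable]
      exact ENNReal.toReal_le_of_le_ofReal (by positivity) h1
    have h5 : ε * F * Q.length ≤ ∫ x in Q.toSet, w x := by
      rw [integral_eq_lintegral_of_nonneg_ae (ae_of_all _ hw) hwm.aestronglyMeasurable]
      refine (ENNReal.ofReal_le_iff_le_toReal ?_).1 ((h3 1 le_rfl (by omega)).trans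
        (lintegral_mono_set (NAdic.child_subset hn0 Q le_rfl (by omega))))
      have := (hint Q).2
      rw [hasFiniteIntegral_iff_ofReal (ae_of_all _ hw)] at this
      exact this.ne
    rw [setAverage_eq, setAverage_eq, hvol, smul_eq_mul, smul_eq_mul]
    have h6 : Q.length⁻¹ * ∫ x in Q.toSet, w x ^ r ≤ C * F ^ r := by
      rw [inv_mul_le_iff₀ hQ]; linarith
    have h7 : ε * F ≤ Q.length⁻¹ * ∫ x in Q.toSet, w x := by
      rw [le_inv_mul_iff₀ hQ]; linarith
    calc (Q.length⁻¹ * ∫ x in Q.toSet, w x ^ r) ^ (1 / r) ≤ (C * F ^ r) ^ (1 / r) :=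
          Real.rpow_le_rpow (mul_nonneg (by positivity) (integral_nonneg hwr)) h6 (by positivity)
      _ = C ^ (1 / r) / ε * (ε * F) := by
          rw [Real.mul_rpow hC.le (by positivity), ← Real.rpow_mul hF.le,
            mul_one_div_cancel hr.ne', Real.rpow_one]
          field_simp
      _ ≤ _ := by gcongr
  · refine ⟨(C / ε).toNNReal, by positivity, fun Q i hi j hj => ?_⟩
    obtain ⟨F, hF, -, h2, h3⟩ := H Q
    have hQ := Q.length_pos hn0
    have hμ : ∀ i, weightMeasure w (Q.child i).toSet =
        ∫⁻ x in (Q.child i).toSet, ENNReal.ofReal (w x) := fun i =>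
      withDensity_apply _ (NAdic.measurableSet_toSet _)
    have hup : ∀ i ∈ Finset.Icc 1 n,
        weightMeasure w (Q.child i).toSet ≤ ENNReal.ofReal (C * F * Q.length) := fun i hi => by
      obtain ⟨h4, h5⟩ := Finset.mem_Icc.1 hi
      rw [hμ]
      exact (lintegral_mono_set (NAdic.child_subset hn0 Q h4 h5)).trans h2
    have hlow : ∀ i ∈ Finset.Icc 1 n,
        ENNReal.ofReal (ε * F * Q.length) ≤ weightMeasure w (Q.child i).toSet := fun i hi => by
      obtain ⟨h4, h5⟩ := Finset.mem_Icc.1 hi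
      rw [hμ]
      exact h3 i h4 h5
    have hX : (0 : ℝ) < C * F * Q.length := by positivity
    have hY : (0 : ℝ) < ε * F * Q.length := by positivity
    constructor
    · refine le_trans (le_of_eq ?_) (ENNReal.div_le_div (hlow i hi) (hup j hj))
      rw [← ENNReal.ofReal_div_of_pos hX, ← ENNReal.ofReal.eq_1,
        ← ENNReal.ofReal_inv_of_pos (by positivity)]
      congr 1
      field_simp
    · refine (ENNReal.div_le_div (hup i hi) (hlow j hj)).trans (le_of_eq ?_)
      rw [← ENNReal.ofReal_div_of_pos hY, ← ENNReal.ofReal.eq_1]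
      congr 1
      field_simp

theorem proposition8p4 (p q : ℕ) (hp : p.Prime) (hq : q.Prime) (hqp : q < p)
    (a b : ℝ) (ha : 0 < a) (ha1 : a < 1) (hb : 1 < b) (hab : ((q : ℝ) - 1) * a + b = q)
    (I : ℕ → NAdic q) (J : ℕ → NAdic p) (α : ℕ → ℕ) (hsel : IsSelection p q I J α) :
    (∀ r : ℝ, 1 < r → r < Real.log q / Real.log b → constructedWeight a b I α ∈ RHAdic p r) ∧
      constructedWeight a b I α ∈ RHAdicOne p := by
  have hlog : 0 < Real.log b := Real.log_pos hb
  have hq2 : (2 : ℝ) ≤ q := by exact_mod_cast hq.two_le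
  have hlogq : 0 < Real.log q := Real.log_pos (by linarith)
  have main : ∀ r : ℝ, 1 < r → r < Real.log q / Real.log b →
      constructedWeight a b I α ∈ RHAdic p r := by
    intro r hr1 hr
    have hsr : Real.logb q b * r < 1 := by
      rw [lt_div_iff₀ hlog] at hr
      rw [Real.logb, div_mul_eq_mul_div, div_lt_one hlogq]
      linarith
    obtain ⟨C, ε, hC, hε, H⟩ :=
      hsel.exists_bounds hp.ne_zero hq.two_le ha ha1.le hb.le hr1.le hsr
    exact mem_RHAdic_of_bounds hp.two_le
      (constructedWeight_nonneg ha (by linarith) I α)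
      (hsel.measurable_constructedWeight hq.two_le a b) (by linarith) hC hε H
  refine ⟨main, ?_⟩
  -- The normalization of `a` and `b` gives `b < q`, so the admissible range of `r` is nonempty.
  have hbq : b < q := by nlinarith
  obtain ⟨r, hr1, hr⟩ := exists_between
    ((one_lt_div hlog).2 (Real.log_lt_log (by linarith) hbq))
  exact mem_iUnion₂.2 ⟨r, hr1, main r hr1 hr⟩
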